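/- Let $X_1,X_2,\dots$ be i.i.d. random variables with values in $[-\pi,\pi)$ (a circular distribution) and distribution function $F(\theta)=P(X_i\le\theta)$ on $[-\pi,\pi)$, with $F(-\pi)=0$. Assume (F): $F$ is twice continuously differentiable on $[-\pi,\pi)$ (one-sided at $-\pi$), where the density $f=F'$ is continuous on the circle, i.e. $f(\theta)\to f(-\pi)$ as $\theta\uparrow\pi$, and $\int_{-\pi}^{\pi}f'(\theta)^2\,d\theta<\infty$. (For instance, both conditions hold if the $2\pi$-periodic extension of $f$ is continuously differentiable.) Let $K_m(s)=\frac1{2\pi}+\frac1\pi\sum_{k=1}^m\bigl(1-\frac{k}{m+1}\bigr)\cos(ks)$ be the Fejér kernel, and $$\hat F_{m,n}(\theta)=\int_{-\pi}^{\theta}\frac1n\sum_{j=1}^nK_m(y-X_j)\,dy,\qquad \mathrm{MISE}(F;\hat F_{m,n})=E\int_{-\pi}^{\pi}\bigl(\hat F_{m,n}(\theta)-F(\theta)\bigr)^2d\theta .$$ With $a_k=\int_{-\pi}^{\pi}f(\theta)\cos(k\theta)\,d\theta$ and $b_k=\int_{-\pi}^{\pi}f(\theta)\sin(k\theta)\,d\theta$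 put $$\theta_2(F)=\frac1\pi\sum_{k=1}^\infty(a_k^2+b_k^2)+\frac2\pi\sum_{k,l=1}^\infty(-1)^{k+l}b_kb_l ,$$ $$\mathrm{AMISE}(m,n)=\frac1n\int_{-\pi}^{\pi}F(\theta)(1-F(\theta))\,d\theta+R_{m,n},\qquad R_{m,n}=-\frac{2\log m}{\pi mn}\bigl(1+2\pi F'(-\pi)\bigr)+\frac{\theta_2(F)}{m^2}.$$ Then: 1. The two series defining $\theta_2(F)$ converge (absolutely). 2. If $m=m(n)\in\mathbb N$ satisfies $m\to\infty$ and $n/m\to\infty$ as $n\to\infty$, then $\mathrm{AMISE}(m,n)$ is the asymptotic mean integrated squared error of $\hat F_{m,n}$, that is, $$\mathrm{MISE}(F;\hat F_{m,n})=\frac1n\int_{-\pi}^{\pi}F(\theta)(1-F(\theta))\,d\theta+R_{m,n}+o\!\left(\frac{\log m}{mn}+\frac1{m^2}\right)\qquad(n\to\infty).$$ 3. For every integer $n\ge1$, the function $m\mapsto\mathrm{AMISE}(m,n)$ of a real variable $m>0$ has exactly one minimizer. A number $m>0$ is this minimizer if and only if $$\bigl(1+2\pi F'(-\pi)\bigr)\,m(\log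 m-1)=\pi\,\theta_2(F)\,n .$$ If $\theta_2(F)\ne0$ and $c=\pi\theta_2(F)/(1+2\pi F'(-\pi))$, the minimizer is $$m_{\mathrm{opt}}=\frac{cn}{W_0(cn/e)},$$ where $W_0$ is the principal branch of the Lambert W function (the inverse of $w\mapsto we^w$ on $[-1,\infty)$). -/

import Mathlib

open Set Filter Topology MeasureTheory ProbabilityTheory Asymptotics

noncomputable section

namespace FejerCDF

/-- The Fejér kernel of order `m`,
`K_m(s) = 1/(2π) + (1/π) ∑_{k=1}^m (1 - k/(m+1)) cos(ks)`. -/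
def fejerKernel (m : ℕ) (s : ℝ) : ℝ :=
  1 / (2 * Real.pi) +
    1 / Real.pi * ∑ k ∈ Finset.Icc 1 m, (1 - (k : ℝ) / ((m : ℝ) + 1)) * Real.cos ((k : ℝ) * s)

/-- The Fejér density estimator at `θ`, from the sample `x 0, …, x (n - 1)`. -/
def densityEstimator (m n : ℕ) (x : ℕ → ℝ) (θ : ℝ) : ℝ :=
  1 / (n : ℝ) * ∑ j ∈ Finset.range n, fejerKernel m (θ - x j)

/-- The Fejér distribution function estimator at `θ`: the integral of the density estimator
over `[-π, θ]`. -/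
def cdfEstimator (m n : ℕ) (x : ℕ → ℝ) (θ : ℝ) : ℝ :=
  ∫ y in (-Real.pi)..θ, densityEstimator m n x y

/-- The mean integrated squared error `E ∫_{-π}^{π} (F̂_{m,n}(θ) - F(θ))² dθ`. -/
def cdfMISE {Ω : Type*} [MeasurableSpace Ω] (P : Measure Ω) (X : ℕ → Ω → ℝ) (F : ℝ → ℝ)
    (m n : ℕ) : ℝ :=
  ∫ ω, (∫ θ in (-Real.pi)..Real.pi,
    (cdfEstimator m n (fun j => X j ω) θ - F θ) ^ 2) ∂P

/-- The derivative of `F` as a function on `[-π, π)`; it is one-sided at `-π`. -/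
def density (F : ℝ → ℝ) (θ : ℝ) : ℝ :=
  derivWithin F (Ico (-Real.pi) Real.pi) θ

/-- The cosine moments `a_k` of the density `F'`. -/
def cosMoment (F : ℝ → ℝ) (k : ℕ) : ℝ :=
  ∫ θ in (-Real.pi)..Real.pi, density F θ * Real.cos ((k : ℝ) * θ)

/-- The sine moments `b_k` of the density `F'`. -/
def sinMoment (F : ℝ → ℝ) (k : ℕ) : ℝ :=
  ∫ θ in (-Real.pi)..Real.pi, density F θ * Real.sin ((k : ℝ) * θ)

/-- The term of index `k + 1` of the series `∑_{k ≥ 1} (a_k² + b_k²)`. -/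
def theta2Single (F : ℝ → ℝ) (k : ℕ) : ℝ :=
  cosMoment F (k + 1) ^ 2 + sinMoment F (k + 1) ^ 2

/-- The term of index `(k + 1, l + 1)` of the double series
`∑_{k,l ≥ 1} (-1)^{k+l} b_k b_l`. -/
def theta2Double (F : ℝ → ℝ) (p : ℕ × ℕ) : ℝ :=
  (-1 : ℝ) ^ ((p.1 + 1) + (p.2 + 1)) * (sinMoment F (p.1 + 1) * sinMoment F (p.2 + 1))

/-- `θ₂(F) = (1/π) ∑_{k≥1} (a_k² + b_k²) + (2/π) ∑_{k,l≥1} (-1)^{k+l} b_k b_l`. -/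
def theta2 (F : ℝ → ℝ) : ℝ :=
  1 / Real.pi * (∑' k : ℕ, theta2Single F k) + 2 / Real.pi * (∑' p : ℕ × ℕ, theta2Double F p)

/-- `R_{m,n} = - (2 log m / (π m n)) (1 + 2π F'(-π)) + θ₂(F) / m²`, for real `m` and `n`. -/
def remainder (F : ℝ → ℝ) (m n : ℝ) : ℝ :=
  -(2 * Real.log m / (Real.pi * m * n)) * (1 + 2 * Real.pi * density F (-Real.pi))
    + theta2 F / m ^ 2

/-- The asymptotic mean integrated squared error `(1/n) ∫_{-π}^{π} F (1 - F) + R_{m,n}`,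
for real `m` and `n`. -/
def cdfAMISE (F : ℝ → ℝ) (m n : ℝ) : ℝ :=
  1 / n * (∫ θ in (-Real.pi)..Real.pi, F θ * (1 - F θ)) + remainder F m n

/-- The principal branch of the Lambert W function, the inverse of the bijection
`w ↦ w eʷ` from `[-1, ∞)` onto `[-1/e, ∞)`. -/
def lambertW0 : ℝ → ℝ :=
  Function.invFunOn (fun w : ℝ => w * Real.exp w) (Ici (-1))

end FejerCDF

end

/-!
The estimator is the average of the cumulative Fejér kernels of the observations, so its mean
squared error at `θ` is `1/n` times the variance of one such kernel plus the squared bias.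

Integrating over the circle and applying Parseval's identity turns both parts into series in the
Fourier coefficients of the density, weighted by powers of the defect `min (k/(m+1)) 1` which the
Fejér multipliers leave at frequency `k`. A factor of this defect costs `1/m` on a summable series:
this gives the limit of `m²` times the squared bias. In the second moment of the kernel the jump of
the sawtooth at `±π` contributes coefficients of order `1/k` only, and the resulting series
`∑ min (k/(m+1)) 1 / k²` is `log m / m` up to `O(1/m)`: a harmonic sum is the source of the
logarithm.

In the variable `1/m` the asymptotic error is a strictly convex function `u log u + b u²` up to
constants, so it has one minimizer, its critical point, which the substitution `m = exp (w + 1)`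
turns into a value of the Lambert function.
-/

noncomputable section

open scoped Real

namespace FejerCDF

/-! ### Real Fourier coefficients on `[-π, π]` -/

/-- The `k`-th cosine coefficient of `g` on `[-π, π]`, without the factor `1 / π`; for
`g = density F` it is `cosMoment F k`. -/
def cosCoeff (g : ℝ → ℝ) (k : ℕ) : ℝ :=
  ∫ x in (-π)..π, g x * Real.cos (k * x)

/-- The `k`-th sine coefficient of `g` on `[-π, π]`, without the factor `1 / π`; for
`g = density F` it is `sinMoment F k`. -/
def sinCoeff (g : ℝ → ℝ) (k : ℕ) : ℝ :=
  ∫ x in (-π)..π, g x * Real.sin (k * x)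

/-- Square integrability on the circle, represented by `(-π, π]`. -/
abbrev SqIntegrable (g : ℝ → ℝ) : Prop :=
  MemLp g 2 (volume.restrict (Ioc (-π) π))

lemma neg_pi_lt_pi : -π < π := by linarith [Real.pi_pos]

lemma SqIntegrable.intervalIntegrable {g : ℝ → ℝ} (hg : SqIntegrable g) :
    IntervalIntegrable g volume (-π) π := by
  rw [intervalIntegrable_iff_integrableOn_Ioc_of_le neg_pi_lt_pi.le]
  exact hg.integrable (by norm_num)

lemma SqIntegrable.intervalIntegrable_mul {g h : ℝ → ℝ} (hg : SqIntegrable g)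
    (hh : SqIntegrable h) : IntervalIntegrable (fun x => g x * h x) volume (-π) π := by
  rw [intervalIntegrable_iff_integrableOn_Ioc_of_le neg_pi_lt_pi.le]
  exact hg.integrable_mul hh

lemma sqIntegrable_of_continuousOn {g : ℝ → ℝ} (hg : ContinuousOn g (Icc (-π) π)) :
    SqIntegrable g := by
  obtain ⟨C, hC⟩ := isCompact_Icc.exists_bound_of_continuousOn hg
  refine MemLp.of_bound ((hg.mono Ioc_subset_Icc_self).aestronglyMeasurable measurableSet_Ioc) C ?_
  exact (ae_restrict_mem measurableSet_Ioc).mono fun x hx => hC x (Ioc_subset_Icc_self hx)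

section Linearity

variable {g h : ℝ → ℝ}

lemma cosCoeff_zero (g : ℝ → ℝ) : cosCoeff g 0 = ∫ x in (-π)..π, g x := by
  simp [cosCoeff]

lemma sinCoeff_zero (g : ℝ → ℝ) : sinCoeff g 0 = 0 := by
  simp [sinCoeff]

lemma cosCoeff_add (hg : IntervalIntegrable g volume (-π) π)
    (hh : IntervalIntegrable h volume (-π) π) (k : ℕ) :
    cosCoeff (fun x => g x + h x) k = cosCoeff g k + cosCoeff h k := by
  simp only [cosCoeff, add_mul]
  exact intervalIntegral.integral_add (hg.mul_continuousOn (by fun_prop))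
    (hh.mul_continuousOn (by fun_prop))

lemma sinCoeff_add (hg : IntervalIntegrable g volume (-π) π)
    (hh : IntervalIntegrable h volume (-π) π) (k : ℕ) :
    sinCoeff (fun x => g x + h x) k = sinCoeff g k + sinCoeff h k := by
  simp only [sinCoeff, add_mul]
  exact intervalIntegral.integral_add (hg.mul_continuousOn (by fun_prop))
    (hh.mul_continuousOn (by fun_prop))

lemma cosCoeff_sub (hg : IntervalIntegrable g volume (-π) π)
    (hh : IntervalIntegrable h volume (-π) π) (k : ℕ) :
    cosCoeff (fun x => g x - h x) k = cosCoeff g k - cosCoeff h k := by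
  simp only [cosCoeff, sub_mul]
  exact intervalIntegral.integral_sub (hg.mul_continuousOn (by fun_prop))
    (hh.mul_continuousOn (by fun_prop))

lemma sinCoeff_sub (hg : IntervalIntegrable g volume (-π) π)
    (hh : IntervalIntegrable h volume (-π) π) (k : ℕ) :
    sinCoeff (fun x => g x - h x) k = sinCoeff g k - sinCoeff h k := by
  simp only [sinCoeff, sub_mul]
  exact intervalIntegral.integral_sub (hg.mul_continuousOn (by fun_prop))
    (hh.mul_continuousOn (by fun_prop))

lemma integral_eq_zero_of_odd (hg : ∀ x, g (-x) = -g x) (a : ℝ) : ∫ x in (-a)..a, g x = 0 := by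
  have h := intervalIntegral.integral_comp_neg (a := -a) (b := a) g
  simp only [hg, neg_neg, intervalIntegral.integral_neg] at h
  linarith

lemma cosCoeff_eq_zero_of_odd (hg : ∀ x, g (-x) = -g x) (k : ℕ) : cosCoeff g k = 0 :=
  integral_eq_zero_of_odd (fun x => by rw [hg, mul_neg, Real.cos_neg, neg_mul]) π

lemma sinCoeff_eq_zero_of_even (hg : ∀ x, g (-x) = g x) (k : ℕ) : sinCoeff g k = 0 :=
  integral_eq_zero_of_odd (fun x => by rw [hg, mul_neg, Real.sin_neg, mul_neg]) π

end Linearity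

section Parseval

variable {g h : ℝ → ℝ}

lemma fourierCoeffOn_ofReal (hg : IntervalIntegrable g volume (-π) π) (n : ℤ) :
    fourierCoeffOn neg_pi_lt_pi (fun x => (g x : ℂ)) n = ((1 / (2 * π) : ℝ) : ℂ) *
      (((∫ x in (-π)..π, g x * Real.cos (n * x) : ℝ) : ℂ) -
        ((∫ x in (-π)..π, g x * Real.sin (n * x) : ℝ) : ℂ) * Complex.I) := by
  have hc : IntervalIntegrable (fun x => ((g x * Real.cos (n * x) : ℝ) : ℂ)) volume (-π) π := by
    have := hg.mul_continuousOn (g := fun x => Real.cos (n * x)) (by fun_prop)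
    exact ⟨this.1.ofReal, this.2.ofReal⟩
  have hs : IntervalIntegrable (fun x => ((g x * Real.sin (n * x) : ℝ) : ℂ) * Complex.I)
      volume (-π) π := by
    have := hg.mul_continuousOn (g := fun x => Real.sin (n * x)) (by fun_prop)
    exact IntervalIntegrable.mul_const ⟨this.1.ofReal, this.2.ofReal⟩ _
  rw [fourierCoeffOn_eq_integral, ← intervalIntegral.integral_ofReal,
    ← intervalIntegral.integral_ofReal, ← intervalIntegral.integral_mul_const,
    ← intervalIntegral.integral_sub hc hs, show π - -π = 2 * π by ring, Complex.real_smul]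
  congr 1
  refine intervalIntegral.integral_congr fun x _ => ?_
  have harg : 2 * (π : ℂ) * Complex.I * ((-n : ℤ) : ℂ) * x / ((2 * π : ℝ) : ℂ)
      = ((-(n * x) : ℝ) : ℂ) * Complex.I := by
    have : (π : ℂ) ≠ 0 := by exact_mod_cast Real.pi_ne_zero
    push_cast
    field_simp
  simp only [fourier_coe_apply, smul_eq_mul]
  rw [harg, Complex.exp_mul_I, ← Complex.ofReal_cos, ← Complex.ofReal_sin, Real.cos_neg,
    Real.sin_neg]
  push_cast
  ring

lemma sq_norm_fourierCoeffOn_ofReal (hg : IntervalIntegrable g volume (-π) π) (n : ℤ) :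
    ‖fourierCoeffOn neg_pi_lt_pi (fun x => (g x : ℂ)) n‖ ^ 2 =
      ((∫ x in (-π)..π, g x * Real.cos (n * x)) ^ 2 +
        (∫ x in (-π)..π, g x * Real.sin (n * x)) ^ 2) / (4 * π ^ 2) := by
  rw [fourierCoeffOn_ofReal hg, norm_mul, mul_pow, sub_eq_add_neg, ← neg_mul,
    ← Complex.ofReal_neg, Complex.sq_norm (_ + _ * _), Complex.normSq_add_mul_I,
    Complex.norm_real, Real.norm_eq_abs, sq_abs]
  ring

lemma hasSum_sq_coeff (hg : SqIntegrable g) :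
    HasSum (fun k : ℕ => cosCoeff g (k + 1) ^ 2 + sinCoeff g (k + 1) ^ 2)
      (π * (∫ x in (-π)..π, g x ^ 2) - cosCoeff g 0 ^ 2 / 2) := by
  have hi := hg.intervalIntegrable
  have hpair : ∀ k : ℕ, ‖fourierCoeffOn neg_pi_lt_pi (fun x => (g x : ℂ)) (k : ℤ)‖ ^ 2 +
      ‖fourierCoeffOn neg_pi_lt_pi (fun x => (g x : ℂ)) (-(k : ℤ))‖ ^ 2 =
      (cosCoeff g k ^ 2 + sinCoeff g k ^ 2) / (2 * π ^ 2) := by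
    intro k
    simp only [sq_norm_fourierCoeffOn_ofReal hi, cosCoeff, sinCoeff, Int.cast_neg,
      Int.cast_natCast, neg_mul, Real.cos_neg, Real.sin_neg, mul_neg,
      intervalIntegral.integral_neg, neg_sq]
    ring
  have hzero : ‖fourierCoeffOn neg_pi_lt_pi (fun x => (g x : ℂ)) 0‖ ^ 2 =
      cosCoeff g 0 ^ 2 / (4 * π ^ 2) := by
    simp [sq_norm_fourierCoeffOn_ofReal hi, cosCoeff_zero]
  have hsum := (hasSum_sq_fourierCoeffOn neg_pi_lt_pi (f := fun x => (g x : ℂ))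
    hg.ofReal).nat_add_neg
  simp only [hpair, hzero] at hsum
  have htail := ((hasSum_nat_add_iff' 1).2 hsum).mul_left (2 * π ^ 2)
  convert! htail using 1
  · funext k
    field_simp
  · simp only [Complex.norm_real, Real.norm_eq_abs, sq_abs, smul_eq_mul, Finset.sum_range_one,
      sinCoeff_zero]
    field_simp
    ring

lemma integral_add_sq_sub_integral_sub_sq (hg : SqIntegrable g) (hh : SqIntegrable h) :
    (∫ x in (-π)..π, (g x + h x) ^ 2) - (∫ x in (-π)..π, (g x - h x) ^ 2) =
      4 * ∫ x in (-π)..π, g x * h x := by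
  have hadd := SqIntegrable.intervalIntegrable_mul (hg.add hh) (hg.add hh)
  have hsub := SqIntegrable.intervalIntegrable_mul (hg.sub hh) (hg.sub hh)
  simp only [Pi.add_apply, Pi.sub_apply, ← sq] at hadd hsub
  rw [← intervalIntegral.integral_sub hadd hsub, ← intervalIntegral.integral_const_mul]
  exact intervalIntegral.integral_congr fun x _ => by ring

lemma hasSum_mul_coeff (hg : SqIntegrable g) (hh : SqIntegrable h) :
    HasSum (fun k : ℕ => cosCoeff g (k + 1) * cosCoeff h (k + 1) +
        sinCoeff g (k + 1) * sinCoeff h (k + 1))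
      (π * (∫ x in (-π)..π, g x * h x) - cosCoeff g 0 * cosCoeff h 0 / 2) := by
  have hgi := hg.intervalIntegrable
  have hhi := hh.intervalIntegrable
  have hpol := ((hasSum_sq_coeff (g := fun x => g x + h x) (hg.add hh)).sub
    (hasSum_sq_coeff (g := fun x => g x - h x) (hg.sub hh))).div_const 4
  simp only [cosCoeff_add hgi hhi, cosCoeff_sub hgi hhi, sinCoeff_add hgi hhi,
    sinCoeff_sub hgi hhi] at hpol
  convert! hpol using 1
  · funext k
    ring
  · linear_combination (-(π / 4)) * integral_add_sq_sub_integral_sub_sq hg hh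

end Parseval

section TrigonometricPolynomials

lemma integral_cos_int_mul (n : ℤ) :
    ∫ x in (-π)..π, Real.cos (n * x) = if n = 0 then 2 * π else 0 := by
  split_ifs with h
  · subst h
    simp
    ring
  · have hn : (n : ℝ) ≠ 0 := by exact_mod_cast h
    rw [intervalIntegral.integral_comp_mul_left (fun x => Real.cos x) hn, integral_cos]
    simp [Real.sin_int_mul_pi]

lemma cosCoeff_cos (j k : ℕ) :
    cosCoeff (fun x => Real.cos (j * x)) (k + 1) = if j = k + 1 then π else 0 := by
  have hprod : ∀ x : ℝ, Real.cos (j * x) * Real.cos ((k + 1 : ℕ) * x) =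
      1 / 2 * (Real.cos (((j - (k + 1 : ℕ) : ℤ) : ℝ) * x) +
        Real.cos (((j + (k + 1 : ℕ) : ℤ) : ℝ) * x)) := by
    intro x
    push_cast
    rw [sub_mul, add_mul (j : ℝ), Real.cos_sub, Real.cos_add]
    ring
  simp only [cosCoeff, hprod]
  rw [intervalIntegral.integral_const_mul, intervalIntegral.integral_add
    (Continuous.intervalIntegrable (by fun_prop) _ _)
    (Continuous.intervalIntegrable (by fun_prop) _ _), integral_cos_int_mul, integral_cos_int_mul,
    if_neg (by omega : ¬ (j + (k + 1 : ℕ) : ℤ) = 0)]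
  grind

lemma sinCoeff_sin (j k : ℕ) :
    sinCoeff (fun x => Real.sin (j * x)) (k + 1) = if j = k + 1 then π else 0 := by
  have hprod : ∀ x : ℝ, Real.sin (j * x) * Real.sin ((k + 1 : ℕ) * x) =
      1 / 2 * (Real.cos (((j - (k + 1 : ℕ) : ℤ) : ℝ) * x) -
        Real.cos (((j + (k + 1 : ℕ) : ℤ) : ℝ) * x)) := by
    intro x
    push_cast
    rw [sub_mul, add_mul (j : ℝ), Real.cos_sub, Real.cos_add]
    ring
  simp only [sinCoeff, hprod]
  rw [intervalIntegral.integral_const_mul, intervalIntegral.integral_sub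
    (Continuous.intervalIntegrable (by fun_prop) _ _)
    (Continuous.intervalIntegrable (by fun_prop) _ _), integral_cos_int_mul, integral_cos_int_mul,
    if_neg (by omega : ¬ (j + (k + 1 : ℕ) : ℤ) = 0)]
  grind

/-- The trigonometric polynomial with constant term `c` and coefficients `p k`, `q k` of
`cos ((k + 1) x)`, `sin ((k + 1) x)`, for `k < m`. -/
def trigPoly (m : ℕ) (c : ℝ) (p q : ℕ → ℝ) (x : ℝ) : ℝ :=
  c + ∑ k ∈ Finset.range m,
    (p k * Real.cos ((k + 1 : ℕ) * x) + q k * Real.sin ((k + 1 : ℕ) * x))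

lemma continuous_trigPoly (m : ℕ) (c : ℝ) (p q : ℕ → ℝ) : Continuous (trigPoly m c p q) := by
  unfold trigPoly
  fun_prop

lemma integral_trigPoly_mul (m : ℕ) (c : ℝ) (p q : ℕ → ℝ) {h : ℝ → ℝ}
    (hh : IntervalIntegrable h volume (-π) π) :
    ∫ x in (-π)..π, trigPoly m c p q x * h x = c * (∫ x in (-π)..π, h x) +
      ∑ k ∈ Finset.range m, (p k * cosCoeff h (k + 1) + q k * sinCoeff h (k + 1)) := by
  have hcos : ∀ k : ℕ, IntervalIntegrable (fun x => p k * (h x * Real.cos ((k + 1 : ℕ) * x)))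
      volume (-π) π := fun k => (hh.mul_continuousOn (by fun_prop)).const_mul _
  have hsin : ∀ k : ℕ, IntervalIntegrable (fun x => q k * (h x * Real.sin ((k + 1 : ℕ) * x)))
      volume (-π) π := fun k => (hh.mul_continuousOn (by fun_prop)).const_mul _
  simp only [cosCoeff, sinCoeff, ← intervalIntegral.integral_const_mul]
  simp only [← intervalIntegral.integral_add (hcos _) (hsin _)]
  rw [← intervalIntegral.integral_finsetSum fun k _ => (hcos k).add (hsin k),
    ← intervalIntegral.integral_add (hh.const_mul c)
      (by simpa only [Finset.sum_fn] using
        IntervalIntegrable.sum (Finset.range m) fun k _ => (hcos k).add (hsin k))]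
  refine intervalIntegral.integral_congr fun x _ => ?_
  simp only [trigPoly, add_mul, Finset.sum_mul]
  congr 1
  exact Finset.sum_congr rfl fun k _ => by ring

lemma cosCoeff_trigPoly_zero (m : ℕ) (c : ℝ) (p q : ℕ → ℝ) :
    cosCoeff (trigPoly m c p q) 0 = 2 * π * c := by
  rw [cosCoeff, integral_trigPoly_mul m c p q (Continuous.intervalIntegrable (by fun_prop) _ _),
    Finset.sum_eq_zero fun k _ => by
      rw [cosCoeff_cos, sinCoeff_eq_zero_of_even (by simp), if_neg (by omega)]
      simp]
  simp
  ring

lemma cosCoeff_trigPoly_succ {m : ℕ} {c : ℝ} {p q : ℕ → ℝ} (hp : ∀ k, m ≤ k → p k = 0) (k : ℕ) :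
    cosCoeff (trigPoly m c p q) (k + 1) = π * p k := by
  have hconst := integral_cos_int_mul ((k + 1 : ℕ) : ℤ)
  rw [if_neg (by omega), Int.cast_natCast] at hconst
  rw [cosCoeff, integral_trigPoly_mul m c p q (Continuous.intervalIntegrable (by fun_prop) _ _),
    hconst]
  have heven : ∀ j, sinCoeff (fun x => Real.cos ((k + 1 : ℕ) * x)) (j + 1) = 0 :=
    fun j => sinCoeff_eq_zero_of_even (by simp) _
  simp only [cosCoeff_cos, heven, add_left_inj, mul_ite, mul_zero, add_zero, zero_add,
    Finset.sum_ite_eq, Finset.mem_range]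
  split_ifs with h
  · ring
  · rw [hp k (by omega), mul_zero]

lemma sinCoeff_trigPoly_succ {m : ℕ} {c : ℝ} {p q : ℕ → ℝ} (hq : ∀ k, m ≤ k → q k = 0) (k : ℕ) :
    sinCoeff (trigPoly m c p q) (k + 1) = π * q k := by
  rw [sinCoeff, integral_trigPoly_mul m c p q (Continuous.intervalIntegrable (by fun_prop) _ _),
    integral_eq_zero_of_odd (by simp)]
  have hodd : ∀ j, cosCoeff (fun x => Real.sin ((k + 1 : ℕ) * x)) (j + 1) = 0 :=
    fun j => cosCoeff_eq_zero_of_odd (by simp) _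
  simp only [sinCoeff_sin, hodd, add_left_inj, mul_ite, mul_zero, zero_add, Finset.sum_ite_eq,
    Finset.mem_range]
  split_ifs with h
  · ring
  · rw [hq k (by omega), mul_zero]

end TrigonometricPolynomials

section IntegrationByParts

variable {g g' : ℝ → ℝ}

lemma cos_nat_succ_mul_pi (k : ℕ) : Real.cos ((k + 1 : ℕ) * π) = -(-1) ^ k := by
  rw [Real.cos_nat_mul_pi, pow_succ, mul_neg_one]

lemma integral_mul_eq_sub_of_hasDerivAt (hg : ContinuousOn g (Icc (-π) π))
    (hd : ∀ x ∈ Ioo (-π) π, HasDerivAt g (g' x) x) (hi : IntervalIntegrable g' volume (-π) π)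
    {v v' : ℝ → ℝ} (hv : ∀ x, HasDerivAt v (v' x) x) (hv' : Continuous v') :
    ∫ x in (-π)..π, g x * v' x =
      g π * v π - g (-π) * v (-π) - ∫ x in (-π)..π, g' x * v x := by
  refine intervalIntegral.integral_mul_deriv_eq_deriv_mul_of_hasDerivAt
    (by rwa [uIcc_of_le neg_pi_lt_pi.le])
    (continuous_iff_continuousAt.2 fun x => (hv x).continuousAt).continuousOn
    (by rwa [min_eq_left neg_pi_lt_pi.le, max_eq_right neg_pi_lt_pi.le])
    (fun x _ => hv x) hi (hv'.intervalIntegrable _ _)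

lemma integral_eq_of_hasDerivAt (hg : ContinuousOn g (Icc (-π) π))
    (hd : ∀ x ∈ Ioo (-π) π, HasDerivAt g (g' x) x) (hi : IntervalIntegrable g' volume (-π) π) :
    ∫ x in (-π)..π, g x = π * (g π + g (-π)) - ∫ x in (-π)..π, x * g' x := by
  have h := integral_mul_eq_sub_of_hasDerivAt hg hd hi hasDerivAt_id continuous_const
  simp only [mul_one, id, mul_comm (g' _)] at h
  rw [h]
  ring

lemma cosCoeff_succ_of_hasDerivAt (hg : ContinuousOn g (Icc (-π) π))
    (hd : ∀ x ∈ Ioo (-π) π, HasDerivAt g (g' x) x) (hi : IntervalIntegrable g' volume (-π) π)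
    (k : ℕ) : cosCoeff g (k + 1) = -sinCoeff g' (k + 1) / (k + 1) := by
  have hk : ((k + 1 : ℕ) : ℝ) ≠ 0 := by positivity
  have hv : ∀ x, HasDerivAt (fun x : ℝ => Real.sin ((k + 1 : ℕ) * x) / (k + 1 : ℕ))
      (Real.cos ((k + 1 : ℕ) * x)) x := fun x =>
    (((hasDerivAt_id x).const_mul _).sin.div_const _).congr_deriv (by field_simp; simp)
  rw [cosCoeff, integral_mul_eq_sub_of_hasDerivAt hg hd hi hv (by fun_prop), mul_neg, Real.sin_neg,
    Real.sin_nat_mul_pi, sinCoeff]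
  simp only [← mul_div_assoc, intervalIntegral.integral_div]
  push_cast
  ring

lemma sinCoeff_succ_of_hasDerivAt (hg : ContinuousOn g (Icc (-π) π))
    (hd : ∀ x ∈ Ioo (-π) π, HasDerivAt g (g' x) x) (hi : IntervalIntegrable g' volume (-π) π)
    (k : ℕ) :
    sinCoeff g (k + 1) = ((g π - g (-π)) * (-1) ^ k + cosCoeff g' (k + 1)) / (k + 1) := by
  have hk : ((k + 1 : ℕ) : ℝ) ≠ 0 := by positivity
  have hv : ∀ x, HasDerivAt (fun x : ℝ => -Real.cos ((k + 1 : ℕ) * x) / (k + 1 : ℕ))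
      (Real.sin ((k + 1 : ℕ) * x)) x := fun x =>
    (((hasDerivAt_id x).const_mul _).cos.neg.div_const _).congr_deriv (by field_simp; simp)
  rw [sinCoeff, integral_mul_eq_sub_of_hasDerivAt hg hd hi hv (by fun_prop), mul_neg, Real.cos_neg,
    cos_nat_succ_mul_pi, cosCoeff]
  simp only [← mul_div_assoc, mul_neg, neg_div, intervalIntegral.integral_neg,
    intervalIntegral.integral_div]
  push_cast
  ring

end IntegrationByParts

/-! ### Fejér weights -/

/-- The amount `1 / (k + 1) - w / (k + 1)` by which the Fejér weight `w` of the frequency `k + 1`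
falls short of `1`, divided by the frequency. -/
def fejerDefect (m k : ℕ) : ℝ := min (1 / ((m : ℝ) + 1)) (1 / ((k : ℝ) + 1))

/-- The Fejér weight `(1 - (k + 1) / (m + 1))⁺` of the frequency `k + 1`. -/
def fejerWeight (m k : ℕ) : ℝ := 1 - (k + 1) * fejerDefect m k

lemma fejerDefect_nonneg (m k : ℕ) : 0 ≤ fejerDefect m k :=
  le_min (by positivity) (by positivity)

lemma fejerDefect_le_one_div_left (m k : ℕ) : fejerDefect m k ≤ 1 / ((m : ℝ) + 1) :=
  min_le_left _ _

lemma fejerDefect_le_one_div_right (m k : ℕ) : fejerDefect m k ≤ 1 / ((k : ℝ) + 1) :=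
  min_le_right _ _

lemma fejerDefect_of_ge {m k : ℕ} (h : k ≤ m) : fejerDefect m k = 1 / ((m : ℝ) + 1) :=
  min_eq_left (by gcongr)

lemma fejerDefect_of_le {m k : ℕ} (h : m ≤ k) : fejerDefect m k = 1 / ((k : ℝ) + 1) :=
  min_eq_right (by gcongr)

lemma fejerWeight_of_ge {m k : ℕ} (h : k ≤ m) :
    fejerWeight m k = 1 - ((k : ℝ) + 1) / ((m : ℝ) + 1) := by
  rw [fejerWeight, fejerDefect_of_ge h, mul_one_div]

lemma fejerWeight_of_le {m k : ℕ} (h : m ≤ k) : fejerWeight m k = 0 := by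
  rw [fejerWeight, fejerDefect_of_le h, mul_one_div_cancel (by positivity), sub_self]

lemma fejerWeight_div_succ (m k : ℕ) :
    fejerWeight m k / (k + 1) = 1 / (k + 1) - fejerDefect m k := by
  have : (k : ℝ) + 1 ≠ 0 := by positivity
  rw [fejerWeight]
  field_simp

section Summability

variable {u : ℕ → ℝ}

lemma summable_one_div_succ_sq : Summable (fun k : ℕ => (1 / ((k : ℝ) + 1)) ^ 2) := by
  refine ((summable_nat_add_iff 1).2 hasSum_zeta_two.summable).congr fun k => ?_
  push_cast
  rw [div_pow, one_pow]

lemma summable_abs_div_succ (hu : Summable fun k => u k ^ 2) :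
    Summable (fun k : ℕ => |u k / ((k : ℝ) + 1)|) := by
  refine Summable.of_nonneg_of_le (fun _ => abs_nonneg _) (fun k => ?_)
    (hu.add summable_one_div_succ_sq)
  rw [div_eq_mul_one_div]
  refine abs_le_of_sq_le_sq ?_ (by positivity)
  nlinarith [sq_nonneg (u k), sq_nonneg (1 / ((k : ℝ) + 1))]

lemma summable_abs_alternating (hu : Summable fun k => |u k|) :
    Summable fun k => |(-1) ^ k * u k| := by
  simpa only [abs_mul, abs_pow, abs_neg, abs_one, one_pow, one_mul] using hu

lemma abs_fejerDefect_mul_le (u : ℕ → ℝ) (m k : ℕ) :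
    ‖fejerDefect m k * u k‖ ≤ 1 / ((m : ℝ) + 1) * |u k| := by
  rw [norm_mul, Real.norm_of_nonneg (fejerDefect_nonneg m k), Real.norm_eq_abs]
  exact mul_le_mul_of_nonneg_right (fejerDefect_le_one_div_left m k) (abs_nonneg _)

lemma summable_fejerDefect_mul (hu : Summable fun k => |u k|) (m : ℕ) :
    Summable (fun k => fejerDefect m k * u k) :=
  Summable.of_norm_bounded (hu.mul_left _) (abs_fejerDefect_mul_le u m)

lemma summable_fejerDefect_div_succ (m : ℕ) :
    Summable (fun k : ℕ => fejerDefect m k / ((k : ℝ) + 1)) := by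
  refine Summable.of_nonneg_of_le (fun k => div_nonneg (fejerDefect_nonneg m k) (by positivity))
    (fun k => ?_) summable_one_div_succ_sq
  rw [sq, div_eq_mul_one_div]
  exact mul_le_mul_of_nonneg_right (fejerDefect_le_one_div_right m k) (by positivity)

lemma hasSum_one_div_add_sub_one_div_add_succ {a : ℝ} (ha : 0 < a) :
    HasSum (fun k : ℕ => 1 / (a + k) - 1 / (a + (k + 1 : ℕ))) (1 / a) := by
  have hlim : Tendsto (fun k : ℕ => 1 / (a + k)) atTop (𝓝 0) := by
    simp only [one_div]
    exact (tendsto_atTop_add_const_left _ _ tendsto_natCast_atTop_atTop).inv_tendsto_atTop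
  rw [hasSum_iff_tendsto_nat_of_nonneg fun k => sub_nonneg.2 (by gcongr; omega)]
  refine (sub_zero (1 / a) ▸ hlim.const_sub (1 / a)).congr fun n => ?_
  rw [Finset.sum_range_sub' fun k : ℕ => 1 / (a + k), Nat.cast_zero, add_zero]

lemma fejerDefect_sq_le (m k : ℕ) :
    fejerDefect m k ^ 2 ≤ 4 * (1 / ((m : ℝ) + 1 + k) - 1 / ((m : ℝ) + 1 + (k + 1 : ℕ))) := by
  have hmin : fejerDefect m k ≤ 2 / ((m : ℝ) + k + 2) := by
    rcases le_total m k with h | h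
    · have : (m : ℝ) ≤ k := by exact_mod_cast h
      rw [fejerDefect_of_le h, div_le_div_iff₀ (by positivity) (by positivity)]
      linarith
    · have : (k : ℝ) ≤ m := by exact_mod_cast h
      rw [fejerDefect_of_ge h, div_le_div_iff₀ (by positivity) (by positivity)]
      linarith
  calc fejerDefect m k ^ 2 ≤ (2 / ((m : ℝ) + k + 2)) ^ 2 := by
        gcongr
        exact fejerDefect_nonneg m k
    _ = 4 / ((m : ℝ) + k + 2) ^ 2 := by rw [div_pow]; norm_num
    _ ≤ 4 / (((m : ℝ) + k + 1) * ((m : ℝ) + k + 2)) := by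
        gcongr
        nlinarith [Nat.cast_nonneg (α := ℝ) m, Nat.cast_nonneg (α := ℝ) k]
    _ = _ := by
        push_cast
        field_simp
        ring

lemma summable_fejerDefect_sq (m : ℕ) : Summable (fun k => fejerDefect m k ^ 2) :=
  Summable.of_nonneg_of_le (fun _ => sq_nonneg _) (fejerDefect_sq_le m)
    ((hasSum_one_div_add_sub_one_div_add_succ (by positivity)).summable.mul_left 4)

end Summability

section Asymptotics

variable {u : ℕ → ℝ}

lemma isBigO_inv_of_abs_le_div_succ {C : ℝ} (h : ∀ m : ℕ, |u m| ≤ C / ((m : ℝ) + 1)) :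
    u =O[atTop] fun m : ℕ => (m : ℝ)⁻¹ := by
  refine IsBigO.of_bound C ?_
  filter_upwards [eventually_ge_atTop 1] with m hm
  have hC : 0 ≤ C := by simpa using (abs_nonneg _).trans (h 0)
  have hm : (0 : ℝ) < m := by exact_mod_cast hm
  calc ‖u m‖ ≤ C / ((m : ℝ) + 1) := h m
    _ ≤ C / m := by gcongr; linarith
    _ = C * ‖(m : ℝ)⁻¹‖ := by rw [norm_inv, Real.norm_of_nonneg hm.le, div_eq_mul_inv]

lemma isBigO_tsum_fejerDefect_mul (hu : Summable fun k => |u k|) :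
    (fun m => ∑' k, fejerDefect m k * u k) =O[atTop] fun m : ℕ => (m : ℝ)⁻¹ := by
  refine isBigO_inv_of_abs_le_div_succ (C := ∑' k, |u k|) fun m => ?_
  have := tsum_of_norm_bounded (hu.hasSum.mul_left (1 / ((m : ℝ) + 1))) (abs_fejerDefect_mul_le u m)
  rwa [Real.norm_eq_abs, one_div_mul_eq_div] at this

lemma isBigO_tsum_fejerDefect_sq :
    (fun m => ∑' k, fejerDefect m k ^ 2) =O[atTop] fun m : ℕ => (m : ℝ)⁻¹ := by
  refine isBigO_inv_of_abs_le_div_succ (C := 4) fun m => ?_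
  have h := (hasSum_one_div_add_sub_one_div_add_succ (a := (m : ℝ) + 1) (by positivity)).mul_left 4
  rw [abs_of_nonneg (tsum_nonneg fun _ => sq_nonneg _), ← mul_one_div, ← h.tsum_eq]
  exact (summable_fejerDefect_sq m).tsum_le_tsum (fejerDefect_sq_le m) h.summable

lemma isBigO_harmonic_div_succ_sub_log_div :
    (fun m : ℕ => (harmonic m : ℝ) / ((m : ℝ) + 1) - Real.log m / m)
      =O[atTop] fun m : ℕ => (m : ℝ)⁻¹ := by
  refine IsBigO.of_bound 1 ?_
  filter_upwards [eventually_ge_atTop 1] with m hm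
  have hm1 : (1 : ℝ) ≤ m := by exact_mod_cast hm
  have hlog_le : Real.log m ≤ m := Real.log_le_self (by linarith)
  have hupper := harmonic_le_one_add_log m
  have hlower : Real.log m ≤ harmonic m :=
    (Real.log_le_log (by linarith) (by push_cast; linarith)).trans (log_add_one_le_harmonic m)
  have hinv : ‖(m : ℝ)⁻¹‖ = 1 / m := by rw [norm_inv, Real.norm_of_nonneg (by linarith), one_div]
  rw [hinv, one_mul, Real.norm_eq_abs, abs_le]
  constructor
  · calc -(1 / (m : ℝ)) ≤ Real.log m / ((m : ℝ) + 1) - Real.log m / m := by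
          rw [le_sub_iff_add_le, neg_add_eq_sub, ← sub_div,
            div_le_div_iff₀ (by linarith) (by linarith)]
          nlinarith
      _ ≤ _ := by gcongr
  · calc (harmonic m : ℝ) / ((m : ℝ) + 1) - Real.log m / m
          ≤ (1 + Real.log m) / m - Real.log m / m := by
          gcongr
          linarith
      _ = 1 / m := by ring

lemma sum_range_fejerDefect_div_succ (m : ℕ) :
    ∑ k ∈ Finset.range m, fejerDefect m k / ((k : ℝ) + 1) = harmonic m / ((m : ℝ) + 1) := by
  rw [harmonic, Rat.cast_sum, Finset.sum_div]
  refine Finset.sum_congr rfl fun k hk => ?_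
  rw [fejerDefect_of_ge (Finset.mem_range.1 hk).le]
  push_cast
  ring

/-- The head of the series is a harmonic sum, which produces the logarithm. -/
lemma isBigO_tsum_fejerDefect_div_succ_sub_log_div :
    (fun m : ℕ => (∑' k : ℕ, fejerDefect m k / ((k : ℝ) + 1)) - Real.log m / m)
      =O[atTop] fun m : ℕ => (m : ℝ)⁻¹ := by
  have htail : (fun m : ℕ => ∑' k : ℕ, fejerDefect m (k + m) ^ 2)
      =O[atTop] fun m : ℕ => (m : ℝ)⁻¹ := by
    refine IsBigO.trans (IsBigO.of_norm_le fun m => ?_) isBigO_tsum_fejerDefect_sq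
    rw [Real.norm_of_nonneg (tsum_nonneg fun _ => sq_nonneg _)]
    have := (summable_fejerDefect_sq m).sum_add_tsum_nat_add m
    linarith [Finset.sum_nonneg fun k (_ : k ∈ Finset.range m) => sq_nonneg (fejerDefect m k)]
  refine (isBigO_harmonic_div_succ_sub_log_div.add htail).congr_left fun m => ?_
  have hsq : ∀ k, fejerDefect m (k + m) / ((k + m : ℕ) + 1) = fejerDefect m (k + m) ^ 2 := by
    intro k
    rw [fejerDefect_of_le (Nat.le_add_left m k)]
    ring
  rw [← (summable_fejerDefect_div_succ m).sum_add_tsum_nat_add m, sum_range_fejerDefect_div_succ]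
  simp only [hsq]
  ring

lemma abs_natCast_mul_fejerDefect_le_one (m k : ℕ) : |(m : ℝ) * fejerDefect m k| ≤ 1 := by
  rw [abs_of_nonneg (mul_nonneg m.cast_nonneg (fejerDefect_nonneg m k))]
  calc (m : ℝ) * fejerDefect m k ≤ m * (1 / ((m : ℝ) + 1)) := by
        gcongr
        exact fejerDefect_le_one_div_left m k
    _ ≤ 1 := by
        rw [mul_one_div, div_le_one (by positivity)]
        linarith

lemma tendsto_natCast_mul_fejerDefect (k : ℕ) :
    Tendsto (fun m : ℕ => (m : ℝ) * fejerDefect m k) atTop (𝓝 1) := by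
  refine (tendsto_natCast_div_add_atTop (1 : ℝ)).congr' ?_
  filter_upwards [eventually_ge_atTop k] with m hm
  rw [fejerDefect_of_ge hm, mul_one_div]

lemma tendsto_pow_mul_tsum_fejerDefect_pow_mul (hu : Summable fun k => |u k|) (p : ℕ) :
    Tendsto (fun m : ℕ => (m : ℝ) ^ p * ∑' k, fejerDefect m k ^ p * u k) atTop
      (𝓝 (∑' k, u k)) := by
  simp only [← tsum_mul_left, ← mul_assoc, ← mul_pow]
  refine tendsto_tsum_of_dominated_convergence hu (fun k => ?_) (.of_forall fun m k => ?_)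
  · simpa using ((tendsto_natCast_mul_fejerDefect k).pow p).mul_const (u k)
  · rw [norm_mul, norm_pow, Real.norm_eq_abs, Real.norm_eq_abs]
    exact mul_le_of_le_one_left (abs_nonneg _)
      (pow_le_one₀ (abs_nonneg _) (abs_natCast_mul_fejerDefect_le_one m k))

end Asymptotics

/-! ### Integrals with a parameter -/

section Parametric

variable {f : ℝ → ℝ} {Ψ : ℝ → ℝ → ℝ} {a b c d : ℝ}

lemma exists_abs_le_of_continuous_uncurry (hΨ : Continuous (Function.uncurry Ψ))
    (a b c d : ℝ) : ∃ C, ∀ θ ∈ uIcc a b, ∀ x ∈ uIcc c d, |Ψ θ x| ≤ C := by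
  obtain ⟨C, hC⟩ := (isCompact_uIcc.prod isCompact_uIcc).exists_bound_of_continuousOn
    (hΨ.continuousOn (s := uIcc a b ×ˢ uIcc c d))
  exact ⟨C, fun θ hθ x hx => hC (θ, x) ⟨hθ, hx⟩⟩

lemma continuousOn_integral_mul (hf : IntervalIntegrable f volume c d)
    (hΨ : Continuous (Function.uncurry Ψ)) (a b : ℝ) :
    ContinuousOn (fun θ => ∫ x in c..d, f x * Ψ θ x) (uIcc a b) := by
  obtain ⟨C, hC⟩ := exists_abs_le_of_continuous_uncurry hΨ a b c d
  intro θ _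
  refine intervalIntegral.continuousWithinAt_of_dominated_interval (bound := fun x => |f x| * C)
    (.of_forall fun θ => hf.aestronglyMeasurable_restrict_uIoc.mul
      (hΨ.uncurry_left θ).aestronglyMeasurable) ?_ (hf.abs.mul_const C)
    (.of_forall fun x _ => ((hΨ.uncurry_right x).const_smul (f x)).continuousWithinAt)
  filter_upwards [self_mem_nhdsWithin] with θ hθ
  refine .of_forall fun x hx => ?_
  rw [norm_mul, Real.norm_eq_abs, Real.norm_eq_abs]
  exact mul_le_mul_of_nonneg_left (hC θ hθ x (uIoc_subset_uIcc hx)) (abs_nonneg _)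

lemma integral_integral_mul_swap (hf : IntervalIntegrable f volume c d)
    (hΨ : Continuous (Function.uncurry Ψ)) (a b : ℝ) :
    ∫ θ in a..b, ∫ x in c..d, f x * Ψ θ x = ∫ x in c..d, f x * ∫ θ in a..b, Ψ θ x := by
  obtain ⟨C, hC⟩ := exists_abs_le_of_continuous_uncurry hΨ a b c d
  have hfin : IsFiniteMeasure (volume.restrict (uIoc a b)) := ⟨by simp [uIoc]⟩
  have hint : Integrable (Function.uncurry fun θ x => f x * Ψ θ x)
      ((volume.restrict (uIoc a b)).prod (volume.restrict (uIoc c d))) := by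
    refine Integrable.mul_bdd (c := C) (hf.def'.comp_snd _) hΨ.aestronglyMeasurable ?_
    rw [Measure.prod_restrict]
    filter_upwards [ae_restrict_mem (measurableSet_uIoc.prod measurableSet_uIoc)] with z hz
    exact hC z.1 (uIoc_subset_uIcc hz.1) z.2 (uIoc_subset_uIcc hz.2)
  rw [Measure.prod_restrict] at hint
  rw [intervalIntegral_intervalIntegral_swap hint]
  simp only [intervalIntegral.integral_const_mul]

lemma cosCoeff_integral_mul (hf : IntervalIntegrable f volume c d)
    (hΨ : Continuous (Function.uncurry Ψ)) (k : ℕ) :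
    cosCoeff (fun θ => ∫ x in c..d, f x * Ψ θ x) k =
      ∫ x in c..d, f x * cosCoeff (fun θ => Ψ θ x) k := by
  simp only [cosCoeff, ← intervalIntegral.integral_mul_const, mul_assoc]
  exact integral_integral_mul_swap (Ψ := fun θ x => Ψ θ x * Real.cos (k * θ)) hf
    (hΨ.mul (g := fun z : ℝ × ℝ => Real.cos (k * z.1)) (by fun_prop)) _ _

lemma sinCoeff_integral_mul (hf : IntervalIntegrable f volume c d)
    (hΨ : Continuous (Function.uncurry Ψ)) (k : ℕ) :
    sinCoeff (fun θ => ∫ x in c..d, f x * Ψ θ x) k =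
      ∫ x in c..d, f x * sinCoeff (fun θ => Ψ θ x) k := by
  simp only [sinCoeff, ← intervalIntegral.integral_mul_const, mul_assoc]
  exact integral_integral_mul_swap (Ψ := fun θ x => Ψ θ x * Real.sin (k * θ)) hf
    (hΨ.mul (g := fun z : ℝ × ℝ => Real.sin (k * z.1)) (by fun_prop)) _ _

lemma hasSum_mul_cosCoeff {u : ℕ → ℝ} (hu : Summable fun k => |u k|)
    (hf : IntervalIntegrable f volume (-π) π) :
    HasSum (fun k => u k * cosCoeff f (k + 1))
      (∫ x in (-π)..π, f x * ∑' k, u k * Real.cos ((k + 1 : ℕ) * x)) := by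
  have hcos : ∀ k x, |u k * Real.cos ((k + 1 : ℕ) * x)| ≤ |u k| := fun k x => by
    rw [abs_mul]
    exact mul_le_of_le_one_right (abs_nonneg _) (Real.abs_cos_le_one _)
  have h := intervalIntegral.hasSum_integral_of_dominated_convergence (μ := volume) (a := -π)
    (b := π) (F := fun k x => f x * (u k * Real.cos ((k + 1 : ℕ) * x)))
    (f := fun x => f x * ∑' k, u k * Real.cos ((k + 1 : ℕ) * x)) (fun k x => |f x| * |u k|)
    (fun k => hf.aestronglyMeasurable_restrict_uIoc.mul
      (Continuous.aestronglyMeasurable (by fun_prop)))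
    (fun k => .of_forall fun x _ => by
      rw [norm_mul, Real.norm_eq_abs, Real.norm_eq_abs]
      exact mul_le_mul_of_nonneg_left (hcos k x) (abs_nonneg _))
    (.of_forall fun x _ => hu.mul_left _)
    (by simpa only [tsum_mul_left] using hf.abs.mul_const _)
    (.of_forall fun x _ => (Summable.of_norm_bounded hu fun k => hcos k x).hasSum.mul_left (f x))
  refine h.congr_fun fun k => ?_
  rw [cosCoeff, ← intervalIntegral.integral_const_mul]
  exact intervalIntegral.integral_congr fun x _ => by ring

end Parametric

/-! ### Distribution functions on the circle and the cumulative Fejér kernel -/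

/-- `F` is a distribution function on the circle cut open at `±π`, with square integrable density
`f`. No sign condition is imposed, so that the notion also covers the primitive of a translated
Fejér kernel. -/
structure IsCircleCdf (F f : ℝ → ℝ) : Prop where
  continuousOn : ContinuousOn F (Icc (-π) π)
  hasDerivAt : ∀ x ∈ Ioo (-π) π, HasDerivAt F (f x) x
  map_neg_pi : F (-π) = 0
  map_pi : F π = 1
  sqIntegrable_density : SqIntegrable f

namespace IsCircleCdf

variable {F f : ℝ → ℝ}

lemma sqIntegrable (h : IsCircleCdf F f) : SqIntegrable F :=
  sqIntegrable_of_continuousOn h.continuousOn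

lemma intervalIntegrable_density (h : IsCircleCdf F f) : IntervalIntegrable f volume (-π) π :=
  h.sqIntegrable_density.intervalIntegrable

lemma integral_density (h : IsCircleCdf F f) : ∫ x in (-π)..π, f x = 1 := by
  rw [intervalIntegral.integral_eq_sub_of_hasDerivAt_of_le neg_pi_lt_pi.le h.continuousOn
    h.hasDerivAt h.intervalIntegrable_density, h.map_pi, h.map_neg_pi, sub_zero]

lemma cosCoeff_zero (h : IsCircleCdf F f) : cosCoeff F 0 = π - ∫ x in (-π)..π, x * f x := by
  rw [FejerCDF.cosCoeff_zero, integral_eq_of_hasDerivAt h.continuousOn h.hasDerivAt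
    h.intervalIntegrable_density, h.map_pi, h.map_neg_pi, add_zero, mul_one]

lemma cosCoeff_succ (h : IsCircleCdf F f) (k : ℕ) :
    cosCoeff F (k + 1) = -sinCoeff f (k + 1) / (k + 1) :=
  cosCoeff_succ_of_hasDerivAt h.continuousOn h.hasDerivAt h.intervalIntegrable_density k

lemma sinCoeff_succ (h : IsCircleCdf F f) (k : ℕ) :
    sinCoeff F (k + 1) = ((-1) ^ k + cosCoeff f (k + 1)) / (k + 1) := by
  rw [sinCoeff_succ_of_hasDerivAt h.continuousOn h.hasDerivAt h.intervalIntegrable_density,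
    h.map_pi, h.map_neg_pi, sub_zero, one_mul]

end IsCircleCdf

lemma fejerKernel_sub_eq_trigPoly (m : ℕ) (y x : ℝ) :
    fejerKernel m (y - x) = trigPoly m (1 / (2 * π))
      (fun k => fejerWeight m k * Real.cos ((k + 1 : ℕ) * x) / π)
      (fun k => fejerWeight m k * Real.sin ((k + 1 : ℕ) * x) / π) y := by
  rw [fejerKernel, trigPoly, show Finset.Icc 1 m = Finset.Ico (0 + 1) (m + 1) by ext; simp,
    ← Finset.sum_Ico_add', ← Finset.range_eq_Ico, Finset.mul_sum]
  congr 1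
  refine Finset.sum_congr rfl fun k hk => ?_
  rw [fejerWeight_of_ge (Finset.mem_range.1 hk).le, mul_sub ((k + 1 : ℕ) : ℝ), Real.cos_sub]
  push_cast
  ring

lemma continuous_fejerKernel (m : ℕ) : Continuous (fejerKernel m) := by
  unfold fejerKernel
  fun_prop

/-- The integral over `[-π, θ]` of the Fejér kernel centred at `x`: the estimator of the
distribution function from the single observation `x`. -/
def fejerCdf (m : ℕ) (θ x : ℝ) : ℝ :=
  ∫ y in (-π)..θ, fejerKernel m (y - x)

lemma continuous_uncurry_fejerCdf (m : ℕ) : Continuous (Function.uncurry (fejerCdf m)) := by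
  have hK : Continuous (Function.uncurry fun (z : ℝ × ℝ) y => fejerKernel m (y - z.2)) :=
    (continuous_fejerKernel m).comp (by fun_prop)
  exact intervalIntegral.continuous_parametric_intervalIntegral_of_continuous
    (μ := volume) hK continuous_fst

lemma cosCoeff_fejerKernel_sub_succ (m : ℕ) (x : ℝ) (k : ℕ) :
    cosCoeff (fun y => fejerKernel m (y - x)) (k + 1) =
      fejerWeight m k * Real.cos ((k + 1 : ℕ) * x) := by
  simp only [fejerKernel_sub_eq_trigPoly]
  rw [cosCoeff_trigPoly_succ fun k hk => by rw [fejerWeight_of_le hk, zero_mul, zero_div],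
    mul_div_cancel₀ _ Real.pi_ne_zero]

lemma sinCoeff_fejerKernel_sub_succ (m : ℕ) (x : ℝ) (k : ℕ) :
    sinCoeff (fun y => fejerKernel m (y - x)) (k + 1) =
      fejerWeight m k * Real.sin ((k + 1 : ℕ) * x) := by
  simp only [fejerKernel_sub_eq_trigPoly]
  rw [sinCoeff_trigPoly_succ fun k hk => by rw [fejerWeight_of_le hk, zero_mul, zero_div],
    mul_div_cancel₀ _ Real.pi_ne_zero]

lemma isCircleCdf_fejerCdf (m : ℕ) (x : ℝ) :
    IsCircleCdf (fun θ => fejerCdf m θ x) (fun y => fejerKernel m (y - x)) where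
  continuousOn := ((continuous_uncurry_fejerCdf m).uncurry_right x).continuousOn
  hasDerivAt θ _ := by
    have hK : Continuous fun y => fejerKernel m (y - x) :=
      (continuous_fejerKernel m).comp (continuous_sub_right x)
    exact intervalIntegral.integral_hasDerivAt_right (hK.intervalIntegrable _ _)
      (hK.stronglyMeasurableAtFilter _ _) hK.continuousAt
  map_neg_pi := intervalIntegral.integral_same
  map_pi := by
    have h := cosCoeff_trigPoly_zero m (1 / (2 * π))
      (fun k => fejerWeight m k * Real.cos ((k + 1 : ℕ) * x) / π)
      (fun k => fejerWeight m k * Real.sin ((k + 1 : ℕ) * x) / π)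
    rw [cosCoeff_zero] at h
    simp only [fejerCdf, fejerKernel_sub_eq_trigPoly, h]
    field_simp
  sqIntegrable_density := sqIntegrable_of_continuousOn
    ((continuous_fejerKernel m).comp (continuous_sub_right x)).continuousOn

/-! ### The sawtooth -/

lemma sinCoeff_id_succ (k : ℕ) : sinCoeff (fun x => x) (k + 1) = 2 * π * (-1) ^ k / (k + 1) := by
  have hconst : cosCoeff (fun _ => 1) (k + 1) = 0 := by
    simpa using cosCoeff_cos 0 k
  rw [sinCoeff_succ_of_hasDerivAt (g := fun x => x) (g' := fun _ => 1) (by fun_prop)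
    (fun x _ => hasDerivAt_id x) (by simp), hconst]
  ring

/-- The Fejér mean of the sawtooth `x / 2`. -/
def fejerSawtooth (m : ℕ) : ℝ → ℝ :=
  trigPoly m 0 (fun _ => 0) (fun k => (-1) ^ k * (fejerWeight m k / (k + 1)))

/-- The error `fejerSawtooth m x - x / 2` of the Fejér mean of the sawtooth. -/
def sawtoothError (m : ℕ) (x : ℝ) : ℝ := fejerSawtooth m x - x / 2

lemma continuous_sawtoothError (m : ℕ) : Continuous (sawtoothError m) :=
  (continuous_trigPoly _ _ _ _).sub (by fun_prop)

lemma sqIntegrable_sawtoothError (m : ℕ) : SqIntegrable (sawtoothError m) :=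
  sqIntegrable_of_continuousOn (continuous_sawtoothError m).continuousOn

lemma sawtoothError_neg (m : ℕ) (x : ℝ) : sawtoothError m (-x) = -sawtoothError m x := by
  simp only [sawtoothError, fejerSawtooth, trigPoly, mul_neg, Real.sin_neg, zero_mul, zero_add,
    Finset.sum_neg_distrib]
  ring

lemma sinCoeff_sawtoothError_succ (m k : ℕ) :
    sinCoeff (sawtoothError m) (k + 1) = -π * ((-1) ^ k * fejerDefect m k) := by
  have hhalf : sinCoeff (fun x => x / 2) (k + 1) = sinCoeff (fun x => x) (k + 1) / 2 := by
    simp only [sinCoeff, ← intervalIntegral.integral_div, div_mul_eq_mul_div]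
  have hfejer : sinCoeff (fejerSawtooth m) (k + 1) = π * ((-1) ^ k * (fejerWeight m k / (k + 1))) :=
    sinCoeff_trigPoly_succ (fun k hk => by rw [fejerWeight_of_le hk, zero_div, mul_zero]) k
  have hsub := sinCoeff_sub (g := fejerSawtooth m) (h := fun x => x / 2)
    ((continuous_trigPoly _ _ _ _).intervalIntegrable _ _)
    (Continuous.intervalIntegrable (by fun_prop) _ _) (k + 1)
  change sinCoeff (fun x => fejerSawtooth m x - x / 2) (k + 1) = _
  rw [hsub, hhalf, hfejer, sinCoeff_id_succ, fejerWeight_div_succ]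
  ring

lemma hasSum_integral_mul_sawtoothError {g : ℝ → ℝ} (hg : SqIntegrable g) (m : ℕ) :
    HasSum (fun k : ℕ => fejerDefect m k * ((-1) ^ k * sinCoeff g (k + 1)))
      (-∫ x in (-π)..π, g x * sawtoothError m x) := by
  have h := (hasSum_mul_coeff hg (sqIntegrable_sawtoothError m)).div_const (-π)
  simp only [cosCoeff_eq_zero_of_odd (sawtoothError_neg m), sinCoeff_sawtoothError_succ, mul_zero,
    zero_add, zero_div, sub_zero, div_neg, mul_div_cancel_left₀ _ Real.pi_ne_zero] at h
  refine h.congr_fun fun k => ?_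
  field_simp

lemma integral_sawtoothError_sq (m : ℕ) :
    ∫ x in (-π)..π, sawtoothError m x ^ 2 = π * ∑' k, fejerDefect m k ^ 2 := by
  have h := (hasSum_integral_mul_sawtoothError (sqIntegrable_sawtoothError m) m).neg
  simp only [sinCoeff_sawtoothError_succ, neg_neg, ← sq] at h
  rw [← tsum_mul_left, ← h.tsum_eq]
  refine tsum_congr fun k => ?_
  have hsign : ((-1 : ℝ) ^ k) ^ 2 = 1 := by rw [← pow_mul, Even.neg_one_pow (by simp)]
  linear_combination (π * fejerDefect m k ^ 2) * hsign

lemma integral_fejerCdf (m : ℕ) (x : ℝ) :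
    ∫ θ in (-π)..π, fejerCdf m θ x = π - x - 2 * sawtoothError m x := by
  have hodd : ∀ k, cosCoeff (fun y : ℝ => y) k = 0 := cosCoeff_eq_zero_of_odd fun _ => rfl
  rw [← cosCoeff_zero, (isCircleCdf_fejerCdf m x).cosCoeff_zero]
  simp only [fejerKernel_sub_eq_trigPoly, mul_comm (_ : ℝ) (trigPoly _ _ _ _ _)]
  rw [integral_trigPoly_mul _ _ _ _ (Continuous.intervalIntegrable (by fun_prop) _ _),
    integral_eq_zero_of_odd (g := fun y => y) (fun _ => rfl)]
  have hterm : ∀ k : ℕ, fejerWeight m k * Real.cos ((k + 1 : ℕ) * x) / π * 0 +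
      fejerWeight m k * Real.sin ((k + 1 : ℕ) * x) / π * (2 * π * (-1) ^ k / (k + 1)) =
      2 * (0 * Real.cos ((k + 1 : ℕ) * x) +
        (-1) ^ k * (fejerWeight m k / (k + 1)) * Real.sin ((k + 1 : ℕ) * x)) := fun k => by
    field_simp
    ring
  simp only [hodd, sinCoeff_id_succ, sawtoothError, fejerSawtooth, trigPoly, hterm,
    ← Finset.mul_sum]
  ring

/-! ### The bias -/

/-- The mean of `fejerCdf m θ x` when `x` is distributed with density `f` on `[-π, π]`. -/
def fejerMean (f : ℝ → ℝ) (m : ℕ) (θ : ℝ) : ℝ :=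
  ∫ x in (-π)..π, f x * fejerCdf m θ x

lemma sqIntegrable_fejerMean {f : ℝ → ℝ} (hf : IntervalIntegrable f volume (-π) π) (m : ℕ) :
    SqIntegrable (fejerMean f m) := by
  have h := continuousOn_integral_mul hf (continuous_uncurry_fejerCdf m) (-π) π
  rw [uIcc_of_le neg_pi_lt_pi.le] at h
  exact sqIntegrable_of_continuousOn h

lemma abs_integral_sq_sub_integral_sq_le {g h : ℝ → ℝ} (hg : SqIntegrable g)
    (hh : SqIntegrable h) {t : ℝ} (ht : 0 < t) :
    |(∫ x in (-π)..π, g x ^ 2) - ∫ x in (-π)..π, h x ^ 2| ≤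
      t⁻¹ * (∫ x in (-π)..π, h x ^ 2) + (t + 1) * ∫ x in (-π)..π, (g x - h x) ^ 2 := by
  have hgg := hg.intervalIntegrable_mul hg
  have hhh := hh.intervalIntegrable_mul hh
  have hsub : SqIntegrable (g - h) := hg.sub hh
  have hdd := hsub.intervalIntegrable_mul hsub
  simp only [Pi.sub_apply, ← sq] at hgg hhh hdd
  rw [← intervalIntegral.integral_sub hgg hhh, ← intervalIntegral.integral_const_mul,
    ← intervalIntegral.integral_const_mul,
    ← intervalIntegral.integral_add (hhh.const_mul _) (hdd.const_mul _)]
  refine (intervalIntegral.abs_integral_le_integral_abs neg_pi_lt_pi.le).trans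
    (intervalIntegral.integral_mono_on neg_pi_lt_pi.le (hgg.sub hhh).abs
      ((hhh.const_mul _).add (hdd.const_mul _)) fun x _ => ?_)
  -- AM-GM for the cross term of `g ^ 2 - h ^ 2 = (g - h) ^ 2 + 2 h (g - h)`
  have hcross : ∀ d, 0 ≤ t⁻¹ * h x ^ 2 + t * d ^ 2 + 2 * (h x * d) := fun d => by
    have hsquare : t⁻¹ * h x ^ 2 + t * d ^ 2 + 2 * (h x * d) = t⁻¹ * (h x + t * d) ^ 2 := by
      field_simp
      ring
    rw [hsquare]
    positivity
  rw [abs_le]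
  constructor
  · linear_combination hcross (g x - h x) + 2 * sq_nonneg (g x - h x)
  · linear_combination hcross (h x - g x)

section Coefficients

variable {f : ℝ → ℝ} (hf : IntervalIntegrable f volume (-π) π)
include hf

lemma cosCoeff_fejerMean_zero (m : ℕ) :
    cosCoeff (fejerMean f m) 0 = π * (∫ x in (-π)..π, f x) - (∫ x in (-π)..π, x * f x) -
      2 * ∫ x in (-π)..π, f x * sawtoothError m x := by
  have hid := hf.continuousOn_mul continuousOn_id
  have herr := hf.mul_continuousOn (continuous_sawtoothError m).continuousOn
  have hexpand : ∀ x, f x * (π - x - 2 * sawtoothError m x) =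
      π * f x - id x * f x - 2 * (f x * sawtoothError m x) := fun x => by
    rw [id]
    ring
  unfold fejerMean
  rw [cosCoeff_integral_mul hf (continuous_uncurry_fejerCdf m)]
  simp only [FejerCDF.cosCoeff_zero, integral_fejerCdf, hexpand]
  rw [intervalIntegral.integral_sub ((hf.const_mul _).sub hid) (herr.const_mul _),
    intervalIntegral.integral_sub (hf.const_mul _) hid, intervalIntegral.integral_const_mul,
    intervalIntegral.integral_const_mul]
  rfl

lemma cosCoeff_fejerMean_succ (m k : ℕ) :
    cosCoeff (fejerMean f m) (k + 1) = -(fejerWeight m k / (k + 1) * sinCoeff f (k + 1)) := by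
  unfold fejerMean
  rw [cosCoeff_integral_mul hf (continuous_uncurry_fejerCdf m)]
  simp only [(isCircleCdf_fejerCdf m _).cosCoeff_succ, sinCoeff_fejerKernel_sub_succ]
  rw [← neg_mul, sinCoeff, ← intervalIntegral.integral_const_mul]
  exact intervalIntegral.integral_congr fun x _ => by ring

lemma sinCoeff_fejerMean_succ (m k : ℕ) :
    sinCoeff (fejerMean f m) (k + 1) = (-1) ^ k / (k + 1) * (∫ x in (-π)..π, f x) +
      fejerWeight m k / (k + 1) * cosCoeff f (k + 1) := by
  unfold fejerMean
  rw [sinCoeff_integral_mul hf (continuous_uncurry_fejerCdf m)]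
  simp only [(isCircleCdf_fejerCdf m _).sinCoeff_succ, cosCoeff_fejerKernel_sub_succ]
  rw [cosCoeff, ← intervalIntegral.integral_const_mul, ← intervalIntegral.integral_const_mul,
    ← intervalIntegral.integral_add (hf.const_mul _)
      ((hf.mul_continuousOn (by fun_prop)).const_mul _)]
  exact intervalIntegral.integral_congr fun x _ => by ring

end Coefficients

namespace IsCircleCdf

variable {F f : ℝ → ℝ}

lemma sqIntegrable_bias (h : IsCircleCdf F f) (m : ℕ) :
    SqIntegrable fun θ => fejerMean f m θ - F θ :=
  (sqIntegrable_fejerMean h.intervalIntegrable_density m).sub h.sqIntegrable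

lemma cosCoeff_bias_zero (h : IsCircleCdf F f) (m : ℕ) :
    cosCoeff (fun θ => fejerMean f m θ - F θ) 0 =
      -2 * ∫ x in (-π)..π, f x * sawtoothError m x := by
  rw [cosCoeff_sub (sqIntegrable_fejerMean h.intervalIntegrable_density m).intervalIntegrable
    h.sqIntegrable.intervalIntegrable, cosCoeff_fejerMean_zero h.intervalIntegrable_density,
    h.cosCoeff_zero, h.integral_density]
  ring

lemma cosCoeff_bias_succ (h : IsCircleCdf F f) (m k : ℕ) :
    cosCoeff (fun θ => fejerMean f m θ - F θ) (k + 1) = fejerDefect m k * sinCoeff f (k + 1) := by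
  rw [cosCoeff_sub (sqIntegrable_fejerMean h.intervalIntegrable_density m).intervalIntegrable
    h.sqIntegrable.intervalIntegrable, cosCoeff_fejerMean_succ h.intervalIntegrable_density,
    h.cosCoeff_succ, fejerWeight_div_succ]
  ring

lemma sinCoeff_bias_succ (h : IsCircleCdf F f) (m k : ℕ) :
    sinCoeff (fun θ => fejerMean f m θ - F θ) (k + 1) =
      -(fejerDefect m k * cosCoeff f (k + 1)) := by
  rw [sinCoeff_sub (sqIntegrable_fejerMean h.intervalIntegrable_density m).intervalIntegrable
    h.sqIntegrable.intervalIntegrable, sinCoeff_fejerMean_succ h.intervalIntegrable_density,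
    h.sinCoeff_succ, h.integral_density, fejerWeight_div_succ]
  ring

lemma integral_bias_sq (h : IsCircleCdf F f) (m : ℕ) :
    ∫ θ in (-π)..π, (fejerMean f m θ - F θ) ^ 2 =
      1 / π * (∑' k, fejerDefect m k ^ 2 * (cosCoeff f (k + 1) ^ 2 + sinCoeff f (k + 1) ^ 2)) +
      2 / π * (∑' k, fejerDefect m k * ((-1) ^ k * sinCoeff f (k + 1))) ^ 2 := by
  have hparseval := hasSum_sq_coeff (h.sqIntegrable_bias m)
  simp only [h.cosCoeff_bias_zero, h.cosCoeff_bias_succ, h.sinCoeff_bias_succ] at hparseval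
  rw [(hasSum_integral_mul_sawtoothError h.sqIntegrable_density m).tsum_eq,
    tsum_congr fun k => show _ = (fejerDefect m k * sinCoeff f (k + 1)) ^ 2 +
      (-(fejerDefect m k * cosCoeff f (k + 1))) ^ 2 by ring, hparseval.tsum_eq]
  field_simp
  ring

lemma tendsto_sq_mul_integral_bias_sq (h : IsCircleCdf F f)
    (hb : Summable fun k => |sinCoeff f (k + 1)|) :
    Tendsto (fun m : ℕ => (m : ℝ) ^ 2 * ∫ θ in (-π)..π, (fejerMean f m θ - F θ) ^ 2) atTop
      (𝓝 (1 / π * (∑' k, (cosCoeff f (k + 1) ^ 2 + sinCoeff f (k + 1) ^ 2)) +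
        2 / π * (∑' k, (-1) ^ k * sinCoeff f (k + 1)) ^ 2)) := by
  have hsq : Summable fun k => |cosCoeff f (k + 1) ^ 2 + sinCoeff f (k + 1) ^ 2| :=
    (hasSum_sq_coeff h.sqIntegrable_density).summable.abs
  have hlim := ((tendsto_pow_mul_tsum_fejerDefect_pow_mul hsq 2).const_mul (1 / π)).add
    (((tendsto_pow_mul_tsum_fejerDefect_pow_mul
      (summable_abs_alternating hb) 1).pow 2).const_mul (2 / π))
  refine hlim.congr fun m => ?_
  simp only [h.integral_bias_sq, pow_one]
  ring

lemma isBigO_integral_fejerMean_sq_sub (h : IsCircleCdf F f)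
    (hb : Summable fun k => |sinCoeff f (k + 1)|) :
    (fun m => (∫ θ in (-π)..π, fejerMean f m θ ^ 2) - ∫ θ in (-π)..π, F θ ^ 2)
      =O[atTop] fun m : ℕ => (m : ℝ)⁻¹ := by
  obtain ⟨C, hC⟩ := (h.tendsto_sq_mul_integral_bias_sq hb).bddAbove_range
  refine IsBigO.of_bound ((∫ θ in (-π)..π, F θ ^ 2) + 2 * C) ?_
  filter_upwards [eventually_ge_atTop 1] with m hm
  have hm : (1 : ℝ) ≤ m := by exact_mod_cast hm
  have hbias : (∫ θ in (-π)..π, (fejerMean f m θ - F θ) ^ 2) ≤ C * (m : ℝ)⁻¹ ^ 2 := by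
    rw [inv_pow, ← div_eq_mul_inv, le_div_iff₀' (by positivity)]
    exact hC ⟨m, rfl⟩
  rw [Real.norm_eq_abs, Real.norm_of_nonneg (by positivity)]
  have hbias_nonneg : 0 ≤ ∫ θ in (-π)..π, (fejerMean f m θ - F θ) ^ 2 :=
    intervalIntegral.integral_nonneg neg_pi_lt_pi.le fun _ _ => sq_nonneg _
  calc |(∫ θ in (-π)..π, fejerMean f m θ ^ 2) - ∫ θ in (-π)..π, F θ ^ 2|
      ≤ (m : ℝ)⁻¹ * (∫ θ in (-π)..π, F θ ^ 2) +
          (m + 1) * ∫ θ in (-π)..π, (fejerMean f m θ - F θ) ^ 2 :=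
        abs_integral_sq_sub_integral_sq_le (sqIntegrable_fejerMean h.intervalIntegrable_density m)
          h.sqIntegrable (by positivity)
    _ ≤ (m : ℝ)⁻¹ * (∫ θ in (-π)..π, F θ ^ 2) + (m + m) * (C * (m : ℝ)⁻¹ ^ 2) := by gcongr
    _ = ((∫ θ in (-π)..π, F θ ^ 2) + 2 * C) * (m : ℝ)⁻¹ := by
        field_simp
        ring

end IsCircleCdf

/-! ### The variance -/

lemma summable_abs_cosCoeff_div_succ {g : ℝ → ℝ} (hg : SqIntegrable g) :
    Summable fun k : ℕ => |cosCoeff g (k + 1) / ((k : ℝ) + 1)| :=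
  summable_abs_div_succ <| (hasSum_sq_coeff hg).summable.of_nonneg_of_le (fun _ => sq_nonneg _)
    fun _ => le_add_of_nonneg_right (sq_nonneg _)

lemma cosCoeff_sq_succ (k : ℕ) :
    cosCoeff (fun x => x ^ 2) (k + 1) = -4 * π * ((-1) ^ k / ((k : ℝ) + 1) ^ 2) := by
  have hk : (k : ℝ) + 1 ≠ 0 := by positivity
  have htwo : sinCoeff (fun x => 2 * x) (k + 1) = 2 * sinCoeff (fun x => x) (k + 1) := by
    simp only [sinCoeff, mul_assoc, intervalIntegral.integral_const_mul]
  rw [cosCoeff_succ_of_hasDerivAt (g' := fun x => 2 * x) (by fun_prop)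
    (fun x _ => by simpa using hasDerivAt_pow 2 x)
    (Continuous.intervalIntegrable (by fun_prop) _ _), htwo, sinCoeff_id_succ]
  field_simp
  ring

lemma hasSum_alternating_cosCoeff_div_sq {f : ℝ → ℝ} (hf : SqIntegrable f) :
    HasSum (fun k : ℕ => (-1) ^ k / ((k : ℝ) + 1) ^ 2 * cosCoeff f (k + 1))
      (π ^ 2 / 12 * (∫ x in (-π)..π, f x) - 1 / 4 * ∫ x in (-π)..π, f x * x ^ 2) := by
  have heven : ∀ k, sinCoeff (fun x : ℝ => x ^ 2) k = 0 :=
    sinCoeff_eq_zero_of_even fun x => neg_sq x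
  have h := (hasSum_mul_coeff hf (sqIntegrable_of_continuousOn (g := fun x => x ^ 2)
    (by fun_prop))).mul_left (-1 / (4 * π))
  simp only [cosCoeff_sq_succ, heven, cosCoeff_zero, integral_pow] at h
  convert! h using 1
  · funext k
    field_simp
    ring
  · field_simp
    ring

lemma hasSum_fejerCdf_sq (m : ℕ) (x : ℝ) :
    HasSum (fun k : ℕ => (1 / ((k : ℝ) + 1)) ^ 2 + (fejerWeight m k / (k + 1)) ^ 2 +
        2 * ((-1) ^ k * fejerWeight m k / ((k : ℝ) + 1) ^ 2 * Real.cos ((k + 1 : ℕ) * x)))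
      (π * (∫ θ in (-π)..π, fejerCdf m θ x ^ 2) -
        (π - x - 2 * sawtoothError m x) ^ 2 / 2) := by
  have h := hasSum_sq_coeff (isCircleCdf_fejerCdf m x).sqIntegrable
  simp only [(isCircleCdf_fejerCdf m x).cosCoeff_succ, (isCircleCdf_fejerCdf m x).sinCoeff_succ,
    cosCoeff_fejerKernel_sub_succ, sinCoeff_fejerKernel_sub_succ, FejerCDF.cosCoeff_zero,
    integral_fejerCdf] at h
  refine h.congr_fun fun k => ?_
  have hsign : ((-1 : ℝ) ^ k) ^ 2 = 1 := by rw [← pow_mul, Even.neg_one_pow (by simp)]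
  have htrig := Real.sin_sq_add_cos_sq ((k + 1 : ℕ) * x)
  field_simp
  linear_combination -fejerWeight m k ^ 2 * htrig - hsign

lemma hasSum_one_div_sq_add_fejerWeight_div_sq (m : ℕ) :
    HasSum (fun k : ℕ => (1 / ((k : ℝ) + 1)) ^ 2 + (fejerWeight m k / (k + 1)) ^ 2)
      (π ^ 2 / 3 + (∑' k, fejerDefect m k ^ 2) -
        2 * ∑' k : ℕ, fejerDefect m k / ((k : ℝ) + 1)) := by
  have hzeta : HasSum (fun k : ℕ => (1 / ((k : ℝ) + 1)) ^ 2) (π ^ 2 / 6) := by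
    simpa using (hasSum_nat_add_iff' 1).2 hasSum_zeta_two
  convert! ((hzeta.mul_left 2).add (summable_fejerDefect_sq m).hasSum).sub
    ((summable_fejerDefect_div_succ m).hasSum.mul_left 2) using 1
  · funext k
    rw [fejerWeight_div_succ]
    ring
  · ring

lemma tsum_alternating_fejerWeight_mul_cos (m : ℕ) (x : ℝ) :
    ∑' k : ℕ, (-1) ^ k * fejerWeight m k / ((k : ℝ) + 1) ^ 2 * Real.cos ((k + 1 : ℕ) * x) =
      (π * (∫ θ in (-π)..π, fejerCdf m θ x ^ 2) - (π - x - 2 * sawtoothError m x) ^ 2 / 2 -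
        (π ^ 2 / 3 + (∑' k, fejerDefect m k ^ 2) -
          2 * ∑' k : ℕ, fejerDefect m k / ((k : ℝ) + 1))) / 2 := by
  have h := (hasSum_fejerCdf_sq m x).sub (hasSum_one_div_sq_add_fejerWeight_div_sq m)
  simp only [add_sub_cancel_left] at h
  rw [← h.tsum_eq, tsum_mul_left, mul_div_cancel_left₀ _ two_ne_zero]

lemma tsum_alternating_fejerWeight_mul_cosCoeff {f : ℝ → ℝ} (hf : SqIntegrable f) (m : ℕ) :
    ∑' k : ℕ, (-1) ^ k * fejerWeight m k / ((k : ℝ) + 1) ^ 2 * cosCoeff f (k + 1) =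
      π ^ 2 / 12 * (∫ x in (-π)..π, f x) - 1 / 4 * (∫ x in (-π)..π, f x * x ^ 2) -
        ∑' k : ℕ, fejerDefect m k * ((-1) ^ k * (cosCoeff f (k + 1) / (k + 1))) := by
  have hfull := hasSum_alternating_cosCoeff_div_sq hf
  have hdefect := summable_fejerDefect_mul
    (summable_abs_alternating (summable_abs_cosCoeff_div_succ hf)) m
  rw [← (hfull.sub hdefect.hasSum).tsum_eq]
  refine tsum_congr fun k => ?_
  simp only [sq, div_mul_eq_div_div, mul_div_assoc, fejerWeight_div_succ]
  ring

lemma summable_abs_alternating_fejerWeight_div_sq (m : ℕ) :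
    Summable fun k : ℕ => |(-1) ^ k * fejerWeight m k / ((k : ℝ) + 1) ^ 2| := by
  refine summable_one_div_succ_sq.of_nonneg_of_le (fun _ => abs_nonneg _) fun k => ?_
  have hk : (0 : ℝ) < (k : ℝ) + 1 := by positivity
  have hle : ((k : ℝ) + 1) * fejerDefect m k ≤ 1 := by
    rw [← le_div_iff₀' hk]
    exact fejerDefect_le_one_div_right m k
  have hnonneg : 0 ≤ ((k : ℝ) + 1) * fejerDefect m k := mul_nonneg hk.le (fejerDefect_nonneg m k)
  rw [abs_div, abs_mul, abs_neg_one_pow, one_mul, abs_of_pos (pow_pos hk 2), one_div_pow]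
  gcongr
  rw [fejerWeight, abs_le]
  constructor <;> linarith

lemma integral_mul_half_sub_sq_half {f H e : ℝ → ℝ} (hf : IntervalIntegrable f volume (-π) π)
    (hH : Continuous H) (he : Continuous e) (c : ℝ) :
    ∫ x in (-π)..π, f x * ((π * H x - (π - x - 2 * e x) ^ 2 / 2 - c) / 2) =
      π / 2 * (∫ x in (-π)..π, f x * H x) + (∫ x in (-π)..π, f x * ((π - x - e x) * e x)) -
        1 / 4 * (∫ x in (-π)..π, f x * x ^ 2) + π / 2 * (∫ x in (-π)..π, f x * x) -
        (π ^ 2 / 4 + c / 2) * ∫ x in (-π)..π, f x := by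
  have hmul : ∀ {u : ℝ → ℝ}, Continuous u →
      IntervalIntegrable (fun x => f x * u x) volume (-π) π :=
    fun hu => hf.mul_continuousOn hu.continuousOn
  have hfH := (hmul hH).const_mul (π / 2)
  have hfe := hmul (u := fun x => (π - x - e x) * e x) (by fun_prop)
  have hfsq := (hmul (u := fun x => x ^ 2) (by fun_prop)).const_mul (1 / 4)
  have hfid := (hmul (u := fun x => x) (by fun_prop)).const_mul (π / 2)
  simp only [← intervalIntegral.integral_const_mul]
  rw [← intervalIntegral.integral_add hfH hfe, ← intervalIntegral.integral_sub (hfH.add hfe) hfsq,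
    ← intervalIntegral.integral_add ((hfH.add hfe).sub hfsq) hfid,
    ← intervalIntegral.integral_sub (((hfH.add hfe).sub hfsq).add hfid) (hf.const_mul _)]
  refine intervalIntegral.integral_congr fun x _ => ?_
  ring

namespace IsCircleCdf

variable {F f : ℝ → ℝ}

lemma integral_mul_integral_fejerCdf_sq (h : IsCircleCdf F f) (m : ℕ) :
    ∫ x in (-π)..π, f x * ∫ θ in (-π)..π, fejerCdf m θ x ^ 2 =
      (∫ x in (-π)..π, F x) + 1 / π * ((∑' k, fejerDefect m k ^ 2) -
        2 * (∑' k : ℕ, fejerDefect m k / ((k : ℝ) + 1)) -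
        2 * ∑' k : ℕ, fejerDefect m k * ((-1) ^ k * (cosCoeff f (k + 1) / (k + 1)))) -
      2 / π * (∫ x in (-π)..π, f x * ((π - x - sawtoothError m x) * sawtoothError m x)) := by
  have hH : Continuous fun x => ∫ θ in (-π)..π, fejerCdf m θ x ^ 2 := by
    have hsq : Continuous (Function.uncurry fun x θ => fejerCdf m θ x ^ 2) :=
      ((continuous_uncurry_fejerCdf m).comp continuous_swap).pow 2
    exact intervalIntegral.continuous_parametric_intervalIntegral_of_continuous' hsq _ _
  have hF : ∫ x in (-π)..π, F x = π - ∫ x in (-π)..π, f x * x := by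
    rw [← FejerCDF.cosCoeff_zero, h.cosCoeff_zero]
    simp only [mul_comm]
  have hsum := (hasSum_mul_cosCoeff (summable_abs_alternating_fejerWeight_div_sq m)
    h.intervalIntegrable_density).tsum_eq
  simp only [tsum_alternating_fejerWeight_mul_cos] at hsum
  rw [tsum_alternating_fejerWeight_mul_cosCoeff h.sqIntegrable_density,
    integral_mul_half_sub_sq_half h.intervalIntegrable_density hH (continuous_sawtoothError m),
    h.integral_density] at hsum
  rw [hF]
  generalize (∫ x in (-π)..π, f x * ∫ θ in (-π)..π, fejerCdf m θ x ^ 2) = V at hsum ⊢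
  generalize (∫ x in (-π)..π, f x * ((π - x - sawtoothError m x) * sawtoothError m x)) = E at hsum ⊢
  generalize (∫ x in (-π)..π, f x * x) = M at hsum ⊢
  generalize (∑' k : ℕ, fejerDefect m k * ((-1) ^ k * (cosCoeff f (k + 1) / (k + 1)))) = S
    at hsum ⊢
  field_simp
  linear_combination -2 * hsum

end IsCircleCdf

/-! ### The logarithmic term of the variance -/

lemma isBigO_integral_mul_sawtoothError {g : ℝ → ℝ} (hg : SqIntegrable g)
    (hb : Summable fun k => |sinCoeff g (k + 1)|) :
    (fun m : ℕ => ∫ x in (-π)..π, g x * sawtoothError m x) =O[atTop] fun m : ℕ => (m : ℝ)⁻¹ := by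
  refine (isBigO_tsum_fejerDefect_mul (summable_abs_alternating hb)).neg_left.congr_left fun m => ?_
  rw [(hasSum_integral_mul_sawtoothError hg m).tsum_eq, neg_neg]

lemma isBigO_integral_mul_sawtoothError_sq {f : ℝ → ℝ} (hf : ContinuousOn f (Icc (-π) π)) :
    (fun m : ℕ => ∫ x in (-π)..π, f x * sawtoothError m x ^ 2)
      =O[atTop] fun m : ℕ => (m : ℝ)⁻¹ := by
  obtain ⟨C, hC⟩ := isCompact_Icc.exists_bound_of_continuousOn hf
  refine (IsBigO.of_norm_le fun m => ?_).trans (isBigO_tsum_fejerDefect_sq.const_mul_left (C * π))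
  rw [mul_assoc, ← integral_sawtoothError_sq, ← intervalIntegral.integral_const_mul]
  refine intervalIntegral.norm_integral_le_of_norm_le neg_pi_lt_pi.le (.of_forall fun x hx => ?_)
    ((((continuous_sawtoothError m).pow 2).const_mul C).intervalIntegrable _ _)
  rw [norm_mul, Real.norm_of_nonneg (sq_nonneg _)]
  exact mul_le_mul_of_nonneg_right (hC x (Ioc_subset_Icc_self hx)) (sq_nonneg _)

/-- `f` belongs to the Sobolev space `H¹` of the circle cut open at `±π`, with derivative `f'` off
the cut. -/
structure IsCircleSobolev (f f' : ℝ → ℝ) : Prop where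
  continuousOn : ContinuousOn f (Icc (-π) π)
  hasDerivAt : ∀ x ∈ Ioo (-π) π, HasDerivAt f (f' x) x
  map_pi : f π = f (-π)
  sqIntegrable_deriv : SqIntegrable f'

namespace IsCircleSobolev

variable {f f' : ℝ → ℝ}

lemma sqIntegrable (h : IsCircleSobolev f f') : SqIntegrable f :=
  sqIntegrable_of_continuousOn h.continuousOn

lemma sinCoeff_succ (h : IsCircleSobolev f f') (k : ℕ) :
    sinCoeff f (k + 1) = cosCoeff f' (k + 1) / (k + 1) := by
  rw [sinCoeff_succ_of_hasDerivAt h.continuousOn h.hasDerivAt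
    h.sqIntegrable_deriv.intervalIntegrable, h.map_pi, sub_self, zero_mul, zero_add]

lemma summable_abs_sinCoeff (h : IsCircleSobolev f f') :
    Summable fun k => |sinCoeff f (k + 1)| := by
  simpa only [h.sinCoeff_succ] using summable_abs_cosCoeff_div_succ h.sqIntegrable_deriv

lemma sqIntegrable_deriv_id_mul (h : IsCircleSobolev f f') :
    SqIntegrable fun x => f x + x * f' x := by
  have hid : MemLp (fun x : ℝ => x) ⊤ (volume.restrict (Ioc (-π) π)) := by
    refine memLp_top_of_bound continuous_id.aestronglyMeasurable π ?_
    filter_upwards [ae_restrict_mem measurableSet_Ioc] with x hx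
    exact abs_le.2 ⟨hx.1.le, hx.2⟩
  exact h.sqIntegrable.add (h.sqIntegrable_deriv.mul hid)

lemma sinCoeff_id_mul_succ (h : IsCircleSobolev f f') (k : ℕ) :
    sinCoeff (fun x => x * f x) (k + 1) =
      (2 * π * f (-π) * (-1) ^ k + cosCoeff (fun x => f x + x * f' x) (k + 1)) / (k + 1) := by
  rw [sinCoeff_succ_of_hasDerivAt (g := fun x => x * f x) (g' := fun x => f x + x * f' x)
    (continuousOn_id.mul h.continuousOn)
    (fun x hx => ((hasDerivAt_id x).mul (h.hasDerivAt x hx)).congr_deriv (by simp))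
    h.sqIntegrable_deriv_id_mul.intervalIntegrable, h.map_pi]
  ring

lemma integral_id_mul_mul_sawtoothError (h : IsCircleSobolev f f') (m : ℕ) :
    ∫ x in (-π)..π, x * f x * sawtoothError m x =
      -(2 * π * f (-π) * ∑' k : ℕ, fejerDefect m k / ((k : ℝ) + 1)) -
        ∑' k : ℕ, fejerDefect m k *
          ((-1) ^ k * (cosCoeff (fun x => f x + x * f' x) (k + 1) / (k + 1))) := by
  have hid : SqIntegrable fun x => x * f x :=
    sqIntegrable_of_continuousOn (continuousOn_id.mul h.continuousOn)
  have hsum := (((summable_fejerDefect_div_succ m).hasSum.mul_left (2 * π * f (-π))).add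
    (summable_fejerDefect_mul (summable_abs_alternating
      (summable_abs_cosCoeff_div_succ h.sqIntegrable_deriv_id_mul)) m).hasSum)
  rw [← neg_inj, ← (hasSum_integral_mul_sawtoothError hid m).tsum_eq, neg_sub', neg_neg,
    sub_neg_eq_add, ← hsum.tsum_eq]
  refine tsum_congr fun k => ?_
  have hsign : ((-1 : ℝ) ^ k) * (-1) ^ k = 1 := by rw [← mul_pow]; simp
  rw [h.sinCoeff_id_mul_succ]
  linear_combination 2 * π * f (-π) * fejerDefect m k / ((k : ℝ) + 1) * hsign

lemma integral_mul_sawtooth_quadratic (h : IsCircleSobolev f f') (m : ℕ) :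
    ∫ x in (-π)..π, f x * ((π - x - sawtoothError m x) * sawtoothError m x) =
      π * (∫ x in (-π)..π, f x * sawtoothError m x) -
        (∫ x in (-π)..π, x * f x * sawtoothError m x) -
        ∫ x in (-π)..π, f x * sawtoothError m x ^ 2 := by
  have hmul : ∀ {u : ℝ → ℝ}, Continuous u →
      IntervalIntegrable (fun x => f x * u x) volume (-π) π :=
    fun hu => h.sqIntegrable.intervalIntegrable.mul_continuousOn hu.continuousOn
  have herr := continuous_sawtoothError m
  have hid : IntervalIntegrable (fun x => x * f x * sawtoothError m x) volume (-π) π :=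
    (hmul (continuous_id.mul herr)).congr fun x _ => by simp only [Pi.mul_apply, id]; ring
  have hsq := hmul (u := fun x => sawtoothError m x ^ 2) (by fun_prop)
  rw [← intervalIntegral.integral_const_mul,
    ← intervalIntegral.integral_sub ((hmul herr).const_mul π) hid,
    ← intervalIntegral.integral_sub (((hmul herr).const_mul π).sub hid) hsq]
  exact intervalIntegral.integral_congr fun x _ => by ring

end IsCircleSobolev

lemma IsCircleCdf.isBigO_integral_mul_integral_fejerCdf_sq {F f f' : ℝ → ℝ} (h : IsCircleCdf F f)
    (hf : IsCircleSobolev f f') :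
    (fun m : ℕ => (∫ x in (-π)..π, f x * ∫ θ in (-π)..π, fejerCdf m θ x ^ 2) -
        (∫ x in (-π)..π, F x) + 2 * Real.log m / (π * m) * (1 + 2 * π * f (-π)))
      =O[atTop] fun m : ℕ => (m : ℝ)⁻¹ := by
  have hcos : ∀ {g : ℝ → ℝ}, SqIntegrable g → (fun m : ℕ =>
      ∑' k : ℕ, fejerDefect m k * ((-1) ^ k * (cosCoeff g (k + 1) / (k + 1))))
        =O[atTop] fun m : ℕ => (m : ℝ)⁻¹ := fun hg =>
    isBigO_tsum_fejerDefect_mul (summable_abs_alternating (summable_abs_cosCoeff_div_succ hg))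
  have hlog := isBigO_tsum_fejerDefect_div_succ_sub_log_div
  have hlinear := isBigO_integral_mul_sawtoothError hf.sqIntegrable hf.summable_abs_sinCoeff
  have hsquare := isBigO_integral_mul_sawtoothError_sq hf.continuousOn
  refine ((((((isBigO_tsum_fejerDefect_sq.const_mul_left (1 / π)).sub
    (hlog.const_mul_left (2 / π * (1 + 2 * π * f (-π))))).sub
    ((hcos h.sqIntegrable_density).const_mul_left (2 / π))).sub (hlinear.const_mul_left 2)).sub
    ((hcos hf.sqIntegrable_deriv_id_mul).const_mul_left (2 / π))).add
    (hsquare.const_mul_left (2 / π))).congr_left fun m => ?_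
  rw [h.integral_mul_integral_fejerCdf_sq, hf.integral_mul_sawtooth_quadratic,
    hf.integral_id_mul_mul_sawtoothError]
  generalize (∫ x in (-π)..π, f x * sawtoothError m x) = I₁
  field_simp
  ring

/-! ### Mean integrated squared error of an average -/

section Average

variable {Ω ι : Type*} [MeasurableSpace Ω] {P : Measure Ω} [IsProbabilityMeasure P] {s : Finset ι}

lemma integral_average_sub_sq {Y : ι → Ω → ℝ} (hs : s.Nonempty) (hY : ∀ i ∈ s, MemLp (Y i) 2 P)
    (hind : (s : Set ι).Pairwise fun i j => IndepFun (Y i) (Y j) P) {M v : ℝ}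
    (hM : ∀ i ∈ s, ∫ ω, Y i ω ∂P = M) (hv : ∀ i ∈ s, variance (Y i) P = v) (c : ℝ) :
    ∫ ω, (1 / (s.card : ℝ) * (∑ i ∈ s, Y i ω) - c) ^ 2 ∂P =
      1 / (s.card : ℝ) * v + (M - c) ^ 2 := by
  have hcard : (s.card : ℝ) ≠ 0 := by exact_mod_cast hs.card_ne_zero
  have havg : MemLp (fun ω => 1 / (s.card : ℝ) * ∑ i ∈ s, Y i ω) 2 P :=
    (memLp_finsetSum _ hY).const_mul _
  have hvar : variance (fun ω => 1 / (s.card : ℝ) * (∑ i ∈ s, Y i ω) - c) P =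
      1 / (s.card : ℝ) * v := by
    have hsum := IndepFun.variance_sum hY hind
    rw [Finset.sum_congr rfl hv, Finset.sum_const, nsmul_eq_mul, Finset.sum_fn] at hsum
    rw [variance_sub_const havg.aestronglyMeasurable, variance_const_mul, hsum]
    field_simp
  have hmean : ∫ ω, (1 / (s.card : ℝ) * (∑ i ∈ s, Y i ω) - c) ∂P = M - c := by
    rw [integral_sub (havg.integrable one_le_two) (integrable_const c), integral_const_mul,
      integral_finsetSum _ fun i hi => (hY i hi).integrable one_le_two, Finset.sum_congr rfl hM,
      Finset.sum_const, nsmul_eq_mul, integral_const, probReal_univ, one_smul]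
    field_simp
  have h := variance_eq_sub (havg.sub (memLp_const c))
  change variance (fun ω => 1 / (s.card : ℝ) * (∑ i ∈ s, Y i ω) - c) P =
    (∫ ω, (1 / (s.card : ℝ) * (∑ i ∈ s, Y i ω) - c) ^ 2 ∂P) -
      (∫ ω, (1 / (s.card : ℝ) * (∑ i ∈ s, Y i ω) - c) ∂P) ^ 2 at h
  rw [hvar, hmean] at h
  rw [h, sub_add_cancel]

variable {T E : Type*} [MeasurableSpace T] [MeasurableSpace E] {ν : Measure T} [SFinite ν]
  {μ : Measure E} {Ψ : T → E → ℝ}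

lemma memLp_average_comp_sub {X : ι → Ω → E} (hX : ∀ i ∈ s, MeasurePreserving (X i) P μ)
    (hΨ : MemLp (Function.uncurry Ψ) 2 (ν.prod μ)) {F : T → ℝ} (hF : MemLp F 2 ν) :
    MemLp (Function.uncurry fun θ ω => 1 / (s.card : ℝ) * (∑ i ∈ s, Ψ θ (X i ω)) - F θ) 2
      (ν.prod P) :=
  ((memLp_finsetSum _ fun i hi => hΨ.comp_measurePreserving
    ((MeasurePreserving.id ν).prod (hX i hi))).const_mul _).sub (hF.comp_fst P)

variable [IsProbabilityMeasure μ]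

lemma ae_memLp_two_of_uncurry (hΨ : MemLp (Function.uncurry Ψ) 2 (ν.prod μ)) :
    ∀ᵐ θ ∂ν, MemLp (Ψ θ) 2 μ := by
  filter_upwards [hΨ.integrable_sq.prod_right_ae, hΨ.aestronglyMeasurable.prodMk_left] with θ h hm
  exact (memLp_two_iff_integrable_sq hm).2 h

lemma memLp_two_integral_of_uncurry (hΨ : MemLp (Function.uncurry Ψ) 2 (ν.prod μ)) :
    MemLp (fun θ => ∫ x, Ψ θ x ∂μ) 2 ν := by
  have hm : AEStronglyMeasurable (fun θ => ∫ x, Ψ θ x ∂μ) ν :=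
    hΨ.aestronglyMeasurable.integral_prod_right'
  rw [memLp_two_iff_integrable_sq hm]
  refine hΨ.integrable_sq.integral_prod_left.mono' (hm.pow 2) ?_
  filter_upwards [ae_memLp_two_of_uncurry hΨ] with θ hθ
  rw [Real.norm_of_nonneg (sq_nonneg _), ← sub_nonneg]
  exact (variance_nonneg _ _).trans_eq (variance_eq_sub hθ)

lemma integral_integral_average_comp_sub_sq {X : ι → Ω → E} (hs : s.Nonempty)
    (hX : ∀ i ∈ s, MeasurePreserving (X i) P μ)
    (hind : (s : Set ι).Pairwise fun i j => IndepFun (X i) (X j) P)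
    (hΨ : MemLp (Function.uncurry Ψ) 2 (ν.prod μ)) {F : T → ℝ} (hF : MemLp F 2 ν) :
    ∫ ω, ∫ θ, (1 / (s.card : ℝ) * (∑ i ∈ s, Ψ θ (X i ω)) - F θ) ^ 2 ∂ν ∂P =
      1 / (s.card : ℝ) * ((∫ x, ∫ θ, Ψ θ x ^ 2 ∂ν ∂μ) - ∫ θ, (∫ x, Ψ θ x ∂μ) ^ 2 ∂ν) +
        ∫ θ, ((∫ x, Ψ θ x ∂μ) - F θ) ^ 2 ∂ν := by
  have hmean := memLp_two_integral_of_uncurry hΨ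
  have hpoint : ∀ᵐ θ ∂ν, ∫ ω, (1 / (s.card : ℝ) * (∑ i ∈ s, Ψ θ (X i ω)) - F θ) ^ 2 ∂P =
      1 / (s.card : ℝ) * ((∫ x, Ψ θ x ^ 2 ∂μ) - (∫ x, Ψ θ x ∂μ) ^ 2) +
        ((∫ x, Ψ θ x ∂μ) - F θ) ^ 2 := by
    filter_upwards [ae_memLp_two_of_uncurry hΨ] with θ hθ
    have hmeas : ∀ i ∈ s, AEMeasurable (Ψ θ) (P.map (X i)) := fun i hi =>
      (hX i hi).map_eq ▸ hθ.aestronglyMeasurable.aemeasurable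
    have hlaw : ∀ i ∈ s, IdentDistrib (fun ω => Ψ θ (X i ω)) (Ψ θ) P μ := fun i hi =>
      have hXi : IdentDistrib (X i) id P μ :=
        ⟨(hX i hi).aemeasurable, aemeasurable_id, by rw [(hX i hi).map_eq, Measure.map_id]⟩
      hXi.comp_of_aemeasurable (hmeas i hi)
    have := integral_average_sub_sq (Y := fun i ω => Ψ θ (X i ω)) hs
      (fun i hi => hθ.comp_measurePreserving (hX i hi))
      (fun i hi j hj hij => (hind hi hj hij).comp₀ (hX i hi).aemeasurable (hX j hj).aemeasurable
        (hmeas i hi) (hmeas j hj))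
      (fun i hi => (hlaw i hi).integral_eq) (fun i hi => (hlaw i hi).variance_eq) (F θ)
    rwa [variance_eq_sub hθ] at this
  have hsecond : Integrable (fun θ => ∫ x, Ψ θ x ^ 2 ∂μ) ν := hΨ.integrable_sq.integral_prod_left
  have hvar : Integrable (fun θ =>
      1 / (s.card : ℝ) * ((∫ x, Ψ θ x ^ 2 ∂μ) - (∫ x, Ψ θ x ∂μ) ^ 2)) ν :=
    (hsecond.sub hmean.integrable_sq).const_mul _
  have hbias : Integrable (fun θ => ((∫ x, Ψ θ x ∂μ) - F θ) ^ 2) ν := (hmean.sub hF).integrable_sq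
  rw [← integral_integral_swap (memLp_average_comp_sub hX hΨ hF).integrable_sq,
    integral_congr_ae hpoint, integral_add hvar hbias, integral_const_mul,
    integral_sub hsecond hmean.integrable_sq, integral_integral_swap hΨ.integrable_sq]

end Average

/-! ### The law of the sample -/

/-- The law on `(-π, π]` with density `f`. -/
def circleLaw (f : ℝ → ℝ) : Measure ℝ :=
  (volume.restrict (Ioc (-π) π)).withDensity fun x => ENNReal.ofReal (f x)

lemma ae_mem_Ioc_circleLaw (f : ℝ → ℝ) : ∀ᵐ x ∂circleLaw f, x ∈ Ioc (-π) π :=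
  (withDensity_absolutelyContinuous _ _).ae_le (ae_restrict_mem measurableSet_Ioc)

lemma ae_restrict_Ioc_of_forall_Ioo {p : ℝ → Prop} {a b : ℝ} (h : ∀ x ∈ Ioo a b, p x) :
    ∀ᵐ x ∂volume.restrict (Ioc a b), p x := by
  rw [← restrict_Ioo_eq_restrict_Ioc]
  exact (ae_restrict_mem measurableSet_Ioo).mono h

lemma integral_circleLaw {f : ℝ → ℝ} (hf : IntervalIntegrable f volume (-π) π)
    (hnonneg : ∀ x ∈ Ioo (-π) π, 0 ≤ f x) (u : ℝ → ℝ) :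
    ∫ x, u x ∂circleLaw f = ∫ x in (-π)..π, f x * u x := by
  rw [circleLaw, integral_withDensity_eq_integral_toReal_smul₀
    hf.1.aestronglyMeasurable.aemeasurable.ennreal_ofReal (by simp),
    intervalIntegral.integral_of_le neg_pi_lt_pi.le]
  refine integral_congr_ae ?_
  filter_upwards [ae_restrict_Ioc_of_forall_Ioo hnonneg] with x hx
  rw [ENNReal.toReal_ofReal hx, smul_eq_mul]

namespace IsCircleCdf

variable {F f : ℝ → ℝ}

lemma lintegral_density (h : IsCircleCdf F f) (hnonneg : ∀ x ∈ Ioo (-π) π, 0 ≤ f x) {a : ℝ}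
    (ha : a ∈ Icc (-π) π) : ∫⁻ x in Ioc (-π) a, ENNReal.ofReal (f x) = ENNReal.ofReal (F a) := by
  have hint : IntervalIntegrable f volume (-π) a := h.intervalIntegrable_density.mono_set (by
    rw [uIcc_of_le ha.1, uIcc_of_le neg_pi_lt_pi.le]
    exact Icc_subset_Icc_right ha.2)
  rw [← ofReal_integral_eq_lintegral_ofReal hint.1
    (ae_restrict_Ioc_of_forall_Ioo fun x hx => hnonneg x ⟨hx.1, hx.2.trans_le ha.2⟩),
    ← intervalIntegral.integral_of_le ha.1,
    intervalIntegral.integral_eq_sub_of_hasDerivAt_of_le ha.1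
      (h.continuousOn.mono (Icc_subset_Icc_right ha.2))
      (fun x hx => h.hasDerivAt x ⟨hx.1, hx.2.trans_le ha.2⟩) hint, h.map_neg_pi, sub_zero]

lemma measurePreserving_circleLaw {Ω : Type*} [MeasurableSpace Ω] {P : Measure Ω}
    [IsProbabilityMeasure P] {Y : Ω → ℝ} (h : IsCircleCdf F f)
    (hnonneg : ∀ x ∈ Ioo (-π) π, 0 ≤ f x) (hY : Measurable Y)
    (hsupp : ∀ᵐ ω ∂P, Y ω ∈ Ico (-π) π)
    (hcdf : ∀ θ ∈ Ico (-π) π, P.real {ω | Y ω ≤ θ} = F θ) :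
    MeasurePreserving Y P (circleLaw f) := by
  have : IsProbabilityMeasure (P.map Y) := Measure.isProbabilityMeasure_map hY.aemeasurable
  refine ⟨hY, Measure.ext_of_Iic _ _ fun a => ?_⟩
  rw [Measure.map_apply hY measurableSet_Iic, circleLaw, withDensity_apply _ measurableSet_Iic,
    Measure.restrict_restrict measurableSet_Iic, inter_comm, Ioc_inter_Iic]
  rcases lt_or_ge a (-π) with hbelow | hbelow
  · rw [Ioc_eq_empty (min_le_right π a |>.trans_lt hbelow).not_gt, Measure.restrict_empty,
      lintegral_zero_measure]
    exact measure_eq_zero_iff_ae_notMem.2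
      (hsupp.mono fun ω hω hω' => (hω.1.trans hω').not_gt hbelow)
  rcases lt_or_ge a π with habove | habove
  · rw [min_eq_right habove.le, h.lintegral_density hnonneg ⟨hbelow, habove.le⟩,
      ← hcdf a ⟨hbelow, habove⟩, ofReal_measureReal]
    rfl
  · rw [min_eq_left habove, h.lintegral_density hnonneg ⟨neg_pi_lt_pi.le, le_rfl⟩, h.map_pi,
      ENNReal.ofReal_one]
    exact (mem_ae_iff_prob_eq_one (hY measurableSet_Iic)).1
      (hsupp.mono fun ω hω => hω.2.le.trans habove)

end IsCircleCdf

/-! ### The mean integrated squared error of the estimator -/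

lemma cdfEstimator_eq_average (m n : ℕ) (x : ℕ → ℝ) (θ : ℝ) :
    cdfEstimator m n x θ = 1 / (n : ℝ) * ∑ j ∈ Finset.range n, fejerCdf m θ (x j) := by
  have hint : ∀ j ∈ Finset.range n,
      IntervalIntegrable (fun y => fejerKernel m (y - x j)) volume (-π) θ := fun j _ =>
    ((continuous_fejerKernel m).comp (continuous_sub_right (x j))).intervalIntegrable _ _
  simp only [cdfEstimator, densityEstimator]
  rw [intervalIntegral.integral_const_mul, intervalIntegral.integral_finsetSum hint]
  rfl

lemma memLp_two_uncurry_fejerCdf (m : ℕ) {f : ℝ → ℝ} [IsFiniteMeasure (circleLaw f)] :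
    MemLp (Function.uncurry (fejerCdf m)) 2
      ((volume.restrict (Ioc (-π) π)).prod (circleLaw f)) := by
  obtain ⟨C, hC⟩ :=
    exists_abs_le_of_continuous_uncurry (continuous_uncurry_fejerCdf m) (-π) π (-π) π
  refine MemLp.of_bound (continuous_uncurry_fejerCdf m).aestronglyMeasurable C ?_
  have hmem : ∀ {x}, x ∈ Ioc (-π) π → x ∈ uIcc (-π) π := fun hx =>
    Icc_subset_uIcc (Ioc_subset_Icc_self hx)
  filter_upwards [Measure.quasiMeasurePreserving_fst.ae (ae_restrict_mem measurableSet_Ioc),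
    Measure.quasiMeasurePreserving_snd.ae (ae_mem_Ioc_circleLaw f)] with z hθ hx
  exact hC _ (hmem hθ) _ (hmem hx)

lemma cdfMISE_eq {Ω : Type*} [MeasurableSpace Ω] {P : Measure Ω} [IsProbabilityMeasure P]
    {X : ℕ → Ω → ℝ} {F f : ℝ → ℝ} (h : IsCircleCdf F f) (hnonneg : ∀ x ∈ Ioo (-π) π, 0 ≤ f x)
    (hX : ∀ i, MeasurePreserving (X i) P (circleLaw f))
    (hindep : Pairwise fun i j => IndepFun (X i) (X j) P) (m : ℕ) {n : ℕ} (hn : n ≠ 0) :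
    cdfMISE P X F m n =
      1 / (n : ℝ) * ((∫ x in (-π)..π, f x * ∫ θ in (-π)..π, fejerCdf m θ x ^ 2) -
        ∫ θ in (-π)..π, fejerMean f m θ ^ 2) +
        ∫ θ in (-π)..π, (fejerMean f m θ - F θ) ^ 2 := by
  have : IsProbabilityMeasure (circleLaw f) :=
    (hX 0).map_eq ▸ Measure.isProbabilityMeasure_map (hX 0).aemeasurable
  have hMISE := integral_integral_average_comp_sub_sq (s := Finset.range n)
    (Finset.nonempty_range_iff.2 hn) (fun i _ => hX i) (hindep.set_pairwise _)
    (memLp_two_uncurry_fejerCdf m) h.sqIntegrable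
  simp only [integral_circleLaw h.intervalIntegrable_density hnonneg, Finset.card_range,
    ← intervalIntegral.integral_of_le neg_pi_lt_pi.le] at hMISE
  simpa only [cdfMISE, cdfEstimator_eq_average, fejerMean] using hMISE

/-! ### Extension to the closed circle -/

lemma tendsto_measureReal_le_nhdsLT {Ω : Type*} [MeasurableSpace Ω] {P : Measure Ω}
    [IsProbabilityMeasure P] {Y : Ω → ℝ} (hY : Measurable Y) {a : ℝ} (ha : ∀ᵐ ω ∂P, Y ω < a) :
    Tendsto (fun θ => P.real {ω | Y ω ≤ θ}) (𝓝[<] a) (𝓝 1) := by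
  have : IsProbabilityMeasure (P.map Y) := Measure.isProbabilityMeasure_map hY.aemeasurable
  have hmass : P (Y ⁻¹' Iio a) = 1 := (mem_ae_iff_prob_eq_one (hY measurableSet_Iio)).1 ha
  have hleft := (cdf (P.map Y)).measure_Iio (tendsto_cdf_atBot _) a
  rw [measure_cdf, Measure.map_apply hY measurableSet_Iio, sub_zero, hmass, eq_comm,
    ENNReal.ofReal_eq_one] at hleft
  have hlim := (monotone_cdf (P.map Y)).tendsto_leftLim a
  rw [hleft] at hlim
  refine hlim.congr fun θ => ?_
  rw [cdf_eq_real, map_measureReal_apply hY measurableSet_Iic]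
  rfl

lemma tendsto_nhdsLT_of_measureReal_le_eq {Ω : Type*} [MeasurableSpace Ω] {P : Measure Ω}
    [IsProbabilityMeasure P] {Y : Ω → ℝ} {F : ℝ → ℝ} {a b : ℝ} (hab : a < b) (hY : Measurable Y)
    (hsupp : ∀ᵐ ω ∂P, Y ω ∈ Ico a b) (hcdf : ∀ θ ∈ Ico a b, P.real {ω | Y ω ≤ θ} = F θ) :
    Tendsto F (𝓝[<] b) (𝓝 1) :=
  (tendsto_measureReal_le_nhdsLT hY (hsupp.mono fun _ hω => hω.2)).congr'
    (eventuallyEq_of_mem (Ico_mem_nhdsLT hab) hcdf)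

lemma monotoneOn_of_measureReal_le_eq {Ω : Type*} [MeasurableSpace Ω] {P : Measure Ω}
    [IsFiniteMeasure P] {Y : Ω → ℝ} {F : ℝ → ℝ} {s : Set ℝ}
    (hcdf : ∀ θ ∈ s, P.real {ω | Y ω ≤ θ} = F θ) : MonotoneOn F s := fun a ha b hb hab => by
  rw [← hcdf a ha, ← hcdf b hb]
  exact measureReal_mono fun _ hω => le_trans hω hab

lemma intervalIntegral_congr_Ico {u v : ℝ → ℝ} {a b : ℝ} (hab : a ≤ b) (h : EqOn u v (Ico a b)) :
    ∫ x in a..b, u x = ∫ x in a..b, v x := by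
  rw [intervalIntegral.integral_of_le hab, intervalIntegral.integral_of_le hab,
    ← restrict_Ico_eq_restrict_Ioc]
  exact setIntegral_congr_fun measurableSet_Ico h

lemma eqOn_update_Ico (u : ℝ → ℝ) (a b c : ℝ) : EqOn (Function.update u b c) u (Ico a b) :=
  fun _ hx => Function.update_of_ne hx.2.ne _ _

lemma continuousOn_update_Icc {u : ℝ → ℝ} {a b c : ℝ} (hab : a < b) (hu : ContinuousOn u (Ico a b))
    (hc : Tendsto u (𝓝[<] b) (𝓝 c)) : ContinuousOn (Function.update u b c) (Icc a b) := by
  rw [continuousOn_update_iff, Icc_sdiff_right, nhdsWithin_Ico_eq_nhdsLT hab]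
  exact ⟨hu, fun _ => hc⟩

lemma hasDerivAt_update_derivWithin_Ico {u : ℝ → ℝ} {a b : ℝ} (c : ℝ)
    (hu : DifferentiableOn ℝ u (Ico a b)) {x : ℝ} (hx : x ∈ Ioo a b) :
    HasDerivAt (Function.update u b c) (derivWithin u (Ico a b) x) x := by
  have hmem := Ico_mem_nhds hx.1 hx.2
  exact ((hu x (Ioo_subset_Ico_self hx)).hasDerivWithinAt.hasDerivAt hmem).congr_of_eventuallyEq
    (eventuallyEq_of_mem hmem (eqOn_update_Ico u a b c))

lemma aestronglyMeasurable_derivWithin_Ico (u : ℝ → ℝ) (a b : ℝ) :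
    AEStronglyMeasurable (derivWithin u (Ico a b)) (volume.restrict (Ioc a b)) := by
  refine (measurable_deriv u).aestronglyMeasurable.congr
    (ae_restrict_Ioc_of_forall_Ioo fun x hx => ?_)
  rw [derivWithin_of_mem_nhds (Ico_mem_nhds hx.1 hx.2)]

/-- The distribution function on `[-π, π]` extending `F` on `[-π, π)`. -/
def closedCdf (F : ℝ → ℝ) : ℝ → ℝ :=
  Function.update F π 1

/-- The density on `[-π, π]`, with the same value at both end points. -/
def closedDensity (F : ℝ → ℝ) : ℝ → ℝ :=
  Function.update (density F) π (density F (-π))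

section Closed

variable {F : ℝ → ℝ}

lemma closedCdf_of_mem_Ico {x : ℝ} (hx : x ∈ Ico (-π) π) : closedCdf F x = F x :=
  eqOn_update_Ico _ _ _ _ hx

lemma closedDensity_of_mem_Ico {x : ℝ} (hx : x ∈ Ico (-π) π) : closedDensity F x = density F x :=
  eqOn_update_Ico _ _ _ _ hx

lemma closedDensity_neg_pi : closedDensity F (-π) = density F (-π) :=
  closedDensity_of_mem_Ico ⟨le_rfl, neg_pi_lt_pi⟩

lemma isCircleSobolev_closedDensity (hf : DifferentiableOn ℝ (density F) (Ico (-π) π))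
    (hper : Tendsto (density F) (𝓝[<] π) (𝓝 (density F (-π))))
    (hsq : IntegrableOn (fun θ => derivWithin (density F) (Ico (-π) π) θ ^ 2) (Ico (-π) π)) :
    IsCircleSobolev (closedDensity F) (derivWithin (density F) (Ico (-π) π)) where
  continuousOn := continuousOn_update_Icc neg_pi_lt_pi hf.continuousOn hper
  hasDerivAt _ hx := hasDerivAt_update_derivWithin_Ico _ hf hx
  map_pi := (Function.update_self _ _ _).trans closedDensity_neg_pi.symm
  sqIntegrable_deriv := by
    rw [IntegrableOn, restrict_Ico_eq_restrict_Ioc] at hsq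
    exact (memLp_two_iff_integrable_sq (aestronglyMeasurable_derivWithin_Ico _ _ _)).2 hsq

lemma isCircleCdf_closedCdf (hF0 : F (-π) = 0) (hF1 : Tendsto F (𝓝[<] π) (𝓝 1))
    (hF : DifferentiableOn ℝ F (Ico (-π) π)) (hf : SqIntegrable (closedDensity F)) :
    IsCircleCdf (closedCdf F) (closedDensity F) where
  continuousOn := continuousOn_update_Icc neg_pi_lt_pi hF.continuousOn hF1
  hasDerivAt x hx := by
    rw [closedDensity_of_mem_Ico (Ioo_subset_Ico_self hx)]
    exact hasDerivAt_update_derivWithin_Ico _ hF hx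
  map_neg_pi := (closedCdf_of_mem_Ico ⟨le_rfl, neg_pi_lt_pi⟩).trans hF0
  map_pi := Function.update_self _ _ _
  sqIntegrable_density := hf

lemma closedDensity_nonneg (hF : MonotoneOn F (Ico (-π) π)) (x : ℝ) : 0 ≤ closedDensity F x := by
  rw [closedDensity, Function.update_apply]
  split_ifs <;> exact hF.derivWithin_nonneg

lemma cdfMISE_closedCdf {Ω : Type*} [MeasurableSpace Ω] (P : Measure Ω) (X : ℕ → Ω → ℝ)
    (F : ℝ → ℝ) (m n : ℕ) : cdfMISE P X (closedCdf F) m n = cdfMISE P X F m n :=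
  integral_congr_ae (.of_forall fun ω => intervalIntegral_congr_Ico neg_pi_lt_pi.le fun θ hθ => by
    rw [closedCdf_of_mem_Ico hθ])

lemma integral_mul_one_sub_eq_closedCdf (hF : SqIntegrable (closedCdf F)) :
    ∫ θ in (-π)..π, F θ * (1 - F θ) =
      (∫ θ in (-π)..π, closedCdf F θ) - ∫ θ in (-π)..π, closedCdf F θ ^ 2 := by
  have hsquare := hF.intervalIntegrable_mul hF
  simp only [← sq] at hsquare
  rw [← intervalIntegral.integral_sub hF.intervalIntegrable hsquare]
  refine intervalIntegral_congr_Ico neg_pi_lt_pi.le fun θ hθ => ?_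
  rw [closedCdf_of_mem_Ico hθ]
  ring

lemma cosMoment_eq_cosCoeff : cosMoment F = cosCoeff (closedDensity F) :=
  funext fun _ => intervalIntegral_congr_Ico neg_pi_lt_pi.le fun x hx => by
    rw [closedDensity_of_mem_Ico hx]

lemma sinMoment_eq_sinCoeff : sinMoment F = sinCoeff (closedDensity F) :=
  funext fun _ => intervalIntegral_congr_Ico neg_pi_lt_pi.le fun x hx => by
    rw [closedDensity_of_mem_Ico hx]

lemma summable_theta2Single (h : SqIntegrable (closedDensity F)) : Summable (theta2Single F) := by
  refine (hasSum_sq_coeff h).summable.congr fun k => ?_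
  rw [theta2Single, cosMoment_eq_cosCoeff, sinMoment_eq_sinCoeff]

lemma theta2Double_eq_mul (F : ℝ → ℝ) (p : ℕ × ℕ) : theta2Double F p =
    ((-1) ^ p.1 * sinMoment F (p.1 + 1)) * ((-1) ^ p.2 * sinMoment F (p.2 + 1)) := by
  rw [theta2Double]
  ring

variable (hb : Summable fun k => |sinCoeff (closedDensity F) (k + 1)|)
include hb

lemma summable_norm_alternating_sinMoment :
    Summable fun k => ‖(-1) ^ k * sinMoment F (k + 1)‖ := by
  rw [sinMoment_eq_sinCoeff]
  exact summable_abs_alternating hb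

lemma summable_theta2Double : Summable (theta2Double F) := by
  simpa only [← theta2Double_eq_mul] using summable_mul_of_summable_norm
    (summable_norm_alternating_sinMoment hb) (summable_norm_alternating_sinMoment hb)

lemma theta2_eq_sq_tsum :
    theta2 F = 1 / π * (∑' k, (cosCoeff (closedDensity F) (k + 1) ^ 2 +
      sinCoeff (closedDensity F) (k + 1) ^ 2)) +
      2 / π * (∑' k, (-1) ^ k * sinCoeff (closedDensity F) (k + 1)) ^ 2 := by
  have hsum := summable_norm_alternating_sinMoment hb
  rw [← cosMoment_eq_cosCoeff, ← sinMoment_eq_sinCoeff, sq,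
    tsum_mul_tsum_of_summable_norm hsum hsum]
  simp only [← theta2Double_eq_mul]
  rfl

lemma theta2_nonneg : 0 ≤ theta2 F := by
  rw [theta2_eq_sq_tsum hb]
  exact add_nonneg (mul_nonneg (by positivity) (tsum_nonneg fun _ => by positivity))
    (by positivity)

end Closed

/-! ### The optimal order -/

lemma lambertW0_mul_exp {t : ℝ} (ht : -Real.exp (-1) ≤ t) :
    lambertW0 t * Real.exp (lambertW0 t) = t := by
  have hcont : ContinuousOn (fun w : ℝ => w * Real.exp w) (Icc (-1) |t|) := by fun_prop
  have hupper : t ≤ |t| * Real.exp |t| := (le_abs_self t).trans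
    (le_mul_of_one_le_right (abs_nonneg t) (Real.one_le_exp (abs_nonneg t)))
  obtain ⟨w, hw, hwt⟩ := intermediate_value_Icc (by linarith [abs_nonneg t]) hcont
    ⟨by simpa only [neg_one_mul] using ht, hupper⟩
  exact Function.invFunOn_eq (f := fun w : ℝ => w * Real.exp w) ⟨w, hw.1, hwt⟩

lemma lambertW0_div_exp_one_mul_exp {t : ℝ} (ht : -1 ≤ t) :
    lambertW0 (t / Real.exp 1) * Real.exp (lambertW0 (t / Real.exp 1) + 1) = t := by
  rw [Real.exp_add, ← mul_assoc, lambertW0_mul_exp, div_mul_cancel₀ _ (Real.exp_ne_zero 1)]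
  rw [Real.exp_neg, le_div_iff₀ (Real.exp_pos 1), neg_mul, inv_mul_cancel₀ (Real.exp_ne_zero 1)]
  exact ht

lemma exp_lambertW0_mul_log_sub_one {t : ℝ} (ht : -1 ≤ t) :
    Real.exp (lambertW0 (t / Real.exp 1) + 1) *
      (Real.log (Real.exp (lambertW0 (t / Real.exp 1) + 1)) - 1) = t := by
  rw [Real.log_exp, add_sub_cancel_right, mul_comm, lambertW0_div_exp_one_mul_exp ht]

lemma div_lambertW0_eq_exp {t : ℝ} (ht : -1 ≤ t) (ht0 : t ≠ 0) :
    t / lambertW0 (t / Real.exp 1) = Real.exp (lambertW0 (t / Real.exp 1) + 1) := by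
  have hW := lambertW0_div_exp_one_mul_exp ht
  rw [div_eq_iff (left_ne_zero_of_mul (hW.trans_ne ht0)), mul_comm, hW]

section Minimizer

variable {a b x : ℝ} (K : ℝ) (ha : 0 < a) (hb : 0 ≤ b)
include ha hb

-- In the variable `1 / y` the function is strictly convex, and the difference of its two sides is
-- the gap to the tangent at `1 / x`.
lemma sub_log_div_add_div_sq_lt (hx : 0 < x) (hcrit : a * (x * (Real.log x - 1)) = 2 * b) {y : ℝ}
    (hy : 0 < y) (hne : y ≠ x) :
    K - a * (Real.log x / x) + b / x ^ 2 < K - a * (Real.log y / y) + b / y ^ 2 := by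
  have hlog : 0 < Real.log x - Real.log y - (1 - y / x) := by
    have h := Real.log_lt_sub_one_of_pos (div_pos hy hx) (div_ne_one_of_ne hne)
    rw [Real.log_div hy.ne' hx.ne'] at h
    linarith
  have hgap : K - a * (Real.log y / y) + b / y ^ 2 - (K - a * (Real.log x / x) + b / x ^ 2) =
      a / y * (Real.log x - Real.log y - (1 - y / x)) + b * (1 / y - 1 / x) ^ 2 := by
    field_simp
    linear_combination (y ^ 2 - y * x) * hcrit
  rw [← sub_pos, hgap]
  positivity

lemma isMinOn_sub_log_div_add_div_sq_iff_eq {z : ℝ} (hz : 0 < z)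
    (hcrit : a * (z * (Real.log z - 1)) = 2 * b) (hx : 0 < x) :
    IsMinOn (fun y : ℝ => K - a * (Real.log y / y) + b / y ^ 2) (Ioi 0) x ↔ x = z := by
  constructor
  · intro hmin
    by_contra hne
    exact (sub_log_div_add_div_sq_lt K ha hb hz hcrit hx hne).not_ge (hmin hz)
  · rintro rfl
    refine isMinOn_iff.2 fun y hy => ?_
    rcases eq_or_ne y x with rfl | hne
    · exact le_rfl
    · exact (sub_log_div_add_div_sq_lt K ha hb hz hcrit hy hne).le

lemma exists_mul_mul_log_sub_one_eq : ∃ z, 0 < z ∧ a * (z * (Real.log z - 1)) = 2 * b := by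
  have ht : -1 ≤ 2 * b / a := (by norm_num : (-1 : ℝ) ≤ 0).trans (by positivity)
  exact ⟨_, Real.exp_pos _, by rw [exp_lambertW0_mul_log_sub_one ht, mul_div_cancel₀ _ ha.ne']⟩

lemma isMinOn_sub_log_div_add_div_sq_iff (hx : 0 < x) :
    IsMinOn (fun y : ℝ => K - a * (Real.log y / y) + b / y ^ 2) (Ioi 0) x ↔
      a * (x * (Real.log x - 1)) = 2 * b := by
  refine ⟨fun hmin => ?_, fun hcrit =>
    (isMinOn_sub_log_div_add_div_sq_iff_eq K ha hb hx hcrit hx).2 rfl⟩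
  obtain ⟨z, hz, hcrit⟩ := exists_mul_mul_log_sub_one_eq ha hb
  rwa [(isMinOn_sub_log_div_add_div_sq_iff_eq K ha hb hz hcrit hx).1 hmin]

lemma existsUnique_isMinOn_sub_log_div_add_div_sq :
    ∃! x : ℝ, 0 < x ∧ IsMinOn (fun y : ℝ => K - a * (Real.log y / y) + b / y ^ 2) (Ioi 0) x := by
  obtain ⟨z, hz, hcrit⟩ := exists_mul_mul_log_sub_one_eq ha hb
  have hiff := fun x (hx : 0 < x) =>
    isMinOn_sub_log_div_add_div_sq_iff_eq K ha hb hz hcrit hx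
  exact ⟨z, ⟨hz, (hiff z hz).2 rfl⟩, fun x ⟨hx, hmin⟩ => (hiff x hx).1 hmin⟩

end Minimizer

lemma cdfAMISE_eq_sub_log_div (F : ℝ → ℝ) (m n : ℝ) :
    cdfAMISE F m n = 1 / n * (∫ θ in (-π)..π, F θ * (1 - F θ)) -
      2 * (1 + 2 * π * density F (-π)) / (π * n) * (Real.log m / m) + theta2 F / m ^ 2 := by
  rw [cdfAMISE, remainder]
  ring

section Order

variable {F : ℝ → ℝ} {n x : ℝ} (hn : 0 < n) (hf : 0 ≤ density F (-π)) (hθ : 0 ≤ theta2 F)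
include hn hf hθ

lemma existsUnique_isMinOn_cdfAMISE :
    ∃! x : ℝ, 0 < x ∧ IsMinOn (fun y => cdfAMISE F y n) (Ioi 0) x := by
  simp only [cdfAMISE_eq_sub_log_div]
  exact existsUnique_isMinOn_sub_log_div_add_div_sq _ (by positivity) hθ

lemma isMinOn_cdfAMISE_iff (hx : 0 < x) :
    IsMinOn (fun y => cdfAMISE F y n) (Ioi 0) x ↔
      (1 + 2 * π * density F (-π)) * (x * (Real.log x - 1)) = π * theta2 F * n := by
  simp only [cdfAMISE_eq_sub_log_div]
  rw [isMinOn_sub_log_div_add_div_sq_iff _ (by positivity) hθ hx, div_mul_eq_mul_div,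
    div_eq_iff (by positivity)]
  constructor <;> intro h <;> linarith

lemma isMinOn_cdfAMISE_div_lambertW0 (hθ0 : theta2 F ≠ 0) {c : ℝ}
    (hc : c = π * theta2 F / (1 + 2 * π * density F (-π))) :
    0 < c * n / lambertW0 (c * n / Real.exp 1) ∧
      IsMinOn (fun y => cdfAMISE F y n) (Ioi 0) (c * n / lambertW0 (c * n / Real.exp 1)) := by
  have : 0 < theta2 F := hθ.lt_of_ne' hθ0
  have hcn : 0 < c * n := by
    rw [hc]
    positivity
  have hcn_ge : -1 ≤ c * n := by linarith
  rw [div_lambertW0_eq_exp hcn_ge hcn.ne', isMinOn_cdfAMISE_iff hn hf hθ (Real.exp_pos _),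
    exp_lambertW0_mul_log_sub_one hcn_ge, hc]
  exact ⟨Real.exp_pos _, by field_simp⟩

end Order

/-! ### The expansion of the mean integrated squared error -/

lemma isLittleO_inv_log_div :
    (fun m : ℕ => (m : ℝ)⁻¹) =o[atTop] fun m : ℕ => Real.log m / m := by
  have hlog : (fun _ : ℕ => (1 : ℝ)) =o[atTop] fun m : ℕ => Real.log m :=
    isLittleO_const_left.2 <| .inr <|
      tendsto_norm_atTop_atTop.comp (Real.tendsto_log_atTop.comp tendsto_natCast_atTop_atTop)
  simpa only [one_mul, div_eq_mul_inv] using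
    hlog.mul_isBigO (isBigO_refl (fun m : ℕ => (m : ℝ)⁻¹) atTop)

lemma isLittleO_sub_div_sq {B : ℕ → ℝ} {θ : ℝ}
    (h : Tendsto (fun m : ℕ => (m : ℝ) ^ 2 * B m) atTop (𝓝 θ)) :
    (fun m : ℕ => B m - θ / (m : ℝ) ^ 2) =o[atTop] fun m : ℕ => 1 / (m : ℝ) ^ 2 := by
  have hzero : (fun m : ℕ => (m : ℝ) ^ 2 * B m - θ) =o[atTop] fun _ => (1 : ℝ) :=
    (isLittleO_one_iff ℝ).2 (by simpa only [sub_self] using h.sub_const θ)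
  refine (hzero.mul_isBigO (isBigO_refl (fun m : ℕ => 1 / (m : ℝ) ^ 2) atTop)).congr' ?_
    (.of_forall fun m => one_mul _)
  filter_upwards [eventually_ne_atTop 0] with m hm
  have : (m : ℝ) ≠ 0 := by exact_mod_cast hm
  field_simp

lemma IsCircleCdf.isLittleO_cdfMISE_sub {Ω : Type*} [MeasurableSpace Ω] {P : Measure Ω}
    [IsProbabilityMeasure P] {X : ℕ → Ω → ℝ} {F f f' : ℝ → ℝ} (h : IsCircleCdf F f)
    (hf : IsCircleSobolev f f') (hnonneg : ∀ x ∈ Ioo (-π) π, 0 ≤ f x)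
    (hX : ∀ i, MeasurePreserving (X i) P (circleLaw f))
    (hindep : Pairwise fun i j => IndepFun (X i) (X j) P)
    {m : ℕ → ℕ} (hm : Tendsto m atTop atTop) :
    (fun n : ℕ => cdfMISE P X F (m n) n -
        (1 / (n : ℝ) * ((∫ θ in (-π)..π, F θ) - ∫ θ in (-π)..π, F θ ^ 2) +
          (-(2 * Real.log (m n) / (π * m n * n)) * (1 + 2 * π * f (-π)) +
            (1 / π * (∑' k, (cosCoeff f (k + 1) ^ 2 + sinCoeff f (k + 1) ^ 2)) +
              2 / π * (∑' k, (-1) ^ k * sinCoeff f (k + 1)) ^ 2) / (m n : ℝ) ^ 2)))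
      =o[atTop] fun n : ℕ => Real.log (m n) / ((m n : ℝ) * (n : ℝ)) + 1 / (m n : ℝ) ^ 2 := by
  have hb := hf.summable_abs_sinCoeff
  have hvar := (((h.isBigO_integral_mul_integral_fejerCdf_sq hf).sub
    (h.isBigO_integral_fejerMean_sq_sub hb)).trans_isLittleO isLittleO_inv_log_div).comp_tendsto hm
  have hbias := (isLittleO_sub_div_sq (h.tendsto_sq_mul_integral_bias_sq hb)).comp_tendsto hm
  refine (((isBigO_refl (fun n : ℕ => 1 / (n : ℝ)) atTop).mul_isLittleO hvar).add_add
    hbias).congr' ?_ (.of_forall fun n => ?_)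
  · filter_upwards [eventually_ne_atTop 0] with n hn
    simp only [Function.comp_apply]
    rw [cdfMISE_eq h hnonneg hX hindep (m n) hn]
    ring
  · have := Real.log_natCast_nonneg (m n)
    simp only [Function.comp_apply]
    rw [Real.norm_of_nonneg (by positivity), Real.norm_of_nonneg (by positivity),
      div_mul_div_comm, one_mul, mul_comm (n : ℝ)]

end FejerCDF

end

open FejerCDF in
theorem mainTheorem5_general {Ω : Type*} [MeasurableSpace Ω] (P : Measure Ω)
    [IsProbabilityMeasure P] (X : ℕ → Ω → ℝ) (F : ℝ → ℝ)
    (hX : ∀ i, Measurable (X i))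
    (hindep : Pairwise fun i j => IndepFun (X i) (X j) P)
    (hsupp : ∀ i, ∀ᵐ ω ∂P, X i ω ∈ Ico (-Real.pi) Real.pi)
    (hcdf : ∀ i, ∀ θ ∈ Ico (-Real.pi) Real.pi, P.real {ω | X i ω ≤ θ} = F θ)
    (hF0 : F (-Real.pi) = 0)
    (hF : DifferentiableOn ℝ F (Ico (-Real.pi) Real.pi))
    (hdensity : DifferentiableOn ℝ (FejerCDF.density F) (Ico (-Real.pi) Real.pi))
    (hper : Tendsto (FejerCDF.density F) (𝓝[<] Real.pi) (𝓝 (FejerCDF.density F (-Real.pi))))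
    (hsq : IntegrableOn
      (fun θ => derivWithin (FejerCDF.density F) (Ico (-Real.pi) Real.pi) θ ^ 2)
      (Ico (-Real.pi) Real.pi)) :
    (Summable (FejerCDF.theta2Single F) ∧ Summable (FejerCDF.theta2Double F)) ∧
    (∀ m : ℕ → ℕ, Tendsto m atTop atTop →
      (fun n : ℕ => FejerCDF.cdfMISE P X F (m n) n -
          (1 / (n : ℝ) * (∫ θ in (-Real.pi)..Real.pi, F θ * (1 - F θ)) +
            FejerCDF.remainder F (m n) n))
        =o[atTop] fun n : ℕ =>
          Real.log (m n) / ((m n : ℝ) * (n : ℝ)) + 1 / (m n : ℝ) ^ 2) ∧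
    (∀ n : ℝ, 0 < n →
      (∃! x : ℝ, 0 < x ∧ IsMinOn (fun y => FejerCDF.cdfAMISE F y n) (Ioi 0) x) ∧
      (∀ x : ℝ, 0 < x →
        (IsMinOn (fun y => FejerCDF.cdfAMISE F y n) (Ioi 0) x ↔
          (1 + 2 * Real.pi * FejerCDF.density F (-Real.pi)) * (x * (Real.log x - 1)) =
            Real.pi * FejerCDF.theta2 F * n)) ∧
      (FejerCDF.theta2 F ≠ 0 →
        ∀ c : ℝ, c = Real.pi * FejerCDF.theta2 F /
            (1 + 2 * Real.pi * FejerCDF.density F (-Real.pi)) →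
          0 < c * n / FejerCDF.lambertW0 (c * n / Real.exp 1) ∧
          IsMinOn (fun y => FejerCDF.cdfAMISE F y n) (Ioi 0)
            (c * n / FejerCDF.lambertW0 (c * n / Real.exp 1)))) := by
  have hF1 := tendsto_nhdsLT_of_measureReal_le_eq neg_pi_lt_pi (hX 0) (hsupp 0) (hcdf 0)
  have hf := isCircleSobolev_closedDensity hdensity hper hsq
  have h := isCircleCdf_closedCdf hF0 hF1 hF hf.sqIntegrable
  have hmono := monotoneOn_of_measureReal_le_eq (hcdf 0)
  have hnonneg : ∀ x, 0 ≤ closedDensity F x := closedDensity_nonneg hmono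
  have hb := hf.summable_abs_sinCoeff
  have hθ := theta2_nonneg hb
  have hf_pi : 0 ≤ density F (-Real.pi) := hmono.derivWithin_nonneg
  refine ⟨⟨summable_theta2Single hf.sqIntegrable, summable_theta2Double hb⟩, fun m hm => ?_,
    fun n hn => ⟨existsUnique_isMinOn_cdfAMISE hn hf_pi hθ,
      fun x hx => isMinOn_cdfAMISE_iff hn hf_pi hθ hx,
      fun hθ0 c hc => isMinOn_cdfAMISE_div_lambertW0 hn hf_pi hθ hθ0 hc⟩⟩
  have hlaw : ∀ i, MeasurePreserving (X i) P (circleLaw (closedDensity F)) := fun i =>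
    h.measurePreserving_circleLaw (fun x _ => hnonneg x) (hX i) (hsupp i) fun θ hθ => by
      rw [hcdf i θ hθ, closedCdf_of_mem_Ico hθ]
  simpa only [remainder, theta2_eq_sq_tsum hb, cdfMISE_closedCdf, closedDensity_neg_pi,
    integral_mul_one_sub_eq_closedCdf h.sqIntegrable] using
    h.isLittleO_cdfMISE_sub hf (fun x _ => hnonneg x) hlaw hindep hm

theorem mainTheorem5 {Ω : Type*} [MeasurableSpace Ω] (P : Measure Ω) [IsProbabilityMeasure P]
    (X : ℕ → Ω → ℝ) (F : ℝ → ℝ)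
    -- an i.i.d. sample on the circle `[-π, π)` with distribution function `F`
    (hX : ∀ i, Measurable (X i))
    (hindep : iIndepFun X P)
    (hsupp : ∀ i, ∀ᵐ ω ∂P, X i ω ∈ Ico (-Real.pi) Real.pi)
    (hcdf : ∀ i, ∀ θ ∈ Ico (-Real.pi) Real.pi, P.real {ω | X i ω ≤ θ} = F θ)
    (hF0 : F (-Real.pi) = 0)
    -- `F` is twice continuously differentiable on `[-π, π)`
    (hF : ContDiffOn ℝ 2 F (Ico (-Real.pi) Real.pi))
    -- the density is continuous on the circle, with a square integrable derivative
    (hper : Tendsto (FejerCDF.density F) (𝓝[<] Real.pi) (𝓝 (FejerCDF.density F (-Real.pi))))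
    (hsq : IntegrableOn
      (fun θ => derivWithin (FejerCDF.density F) (Ico (-Real.pi) Real.pi) θ ^ 2)
      (Ico (-Real.pi) Real.pi)) :
    -- the series in `θ₂(F)` converge
    (Summable (FejerCDF.theta2Single F) ∧ Summable (FejerCDF.theta2Double F)) ∧
    -- the expansion of the mean integrated squared error
    (∀ m : ℕ → ℕ, Tendsto m atTop atTop →
      Tendsto (fun n : ℕ => (n : ℝ) / (m n : ℝ)) atTop atTop →
      (fun n : ℕ => FejerCDF.cdfMISE P X F (m n) n -
          (1 / (n : ℝ) * (∫ θ in (-Real.pi)..Real.pi, F θ * (1 - F θ)) +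
            FejerCDF.remainder F (m n) n))
        =o[atTop] fun n : ℕ =>
          Real.log (m n) / ((m n : ℝ) * (n : ℝ)) + 1 / (m n : ℝ) ^ 2) ∧
    -- the optimal order
    (∀ n : ℕ, 1 ≤ n →
      (∃! x : ℝ, 0 < x ∧ IsMinOn (fun y => FejerCDF.cdfAMISE F y n) (Ioi 0) x) ∧
      (∀ x : ℝ, 0 < x →
        (IsMinOn (fun y => FejerCDF.cdfAMISE F y n) (Ioi 0) x ↔
          (1 + 2 * Real.pi * FejerCDF.density F (-Real.pi)) * (x * (Real.log x - 1)) =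
            Real.pi * FejerCDF.theta2 F * n)) ∧
      (FejerCDF.theta2 F ≠ 0 →
        ∀ c : ℝ, c = Real.pi * FejerCDF.theta2 F /
            (1 + 2 * Real.pi * FejerCDF.density F (-Real.pi)) →
          0 < c * n / FejerCDF.lambertW0 (c * n / Real.exp 1) ∧
          IsMinOn (fun y => FejerCDF.cdfAMISE F y n) (Ioi 0)
            (c * n / FejerCDF.lambertW0 (c * n / Real.exp 1)))) := by
  have hf : ContDiffOn ℝ 1 (FejerCDF.density F) (Ico (-Real.pi) Real.pi) :=
    hF.derivWithin (uniqueDiffOn_Ico _ _) (by norm_num)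
  obtain ⟨hsummable, hMISE, hmin⟩ := mainTheorem5_general P X F hX
    (fun _ _ hij => hindep.indepFun hij) hsupp hcdf hF0 (hF.differentiableOn two_ne_zero)
    (hf.differentiableOn one_ne_zero) hper hsq
  exact ⟨hsummable, fun m hm _ => hMISE m hm, fun n hn => hmin n (by exact_mod_cast hn)⟩
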